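/- Let $d\ge 1$ and equip $\mathbb R^d$ with the Euclidean norm. Consider laws $\mathbb P_{X,Y}$ of a pair $(X,Y)\in\mathbb R^d\times\{0,1\}$ such that $X$ has a density $\mu$ with respect to Lebesgue measure, $\Omega=\{\mu>0\}$ is open, and, given $X=x$, $Y$ is Bernoulli with parameter $\eta(x)$. For constants $\alpha,L,M,\kappa,\delta_0,\varepsilon_0>0$ and a function $\psi$: - $\mathcal F_{L,\alpha}$ is the set of laws with $|\eta(x_1)-\eta(x_2)|\le L\|x_1-x_2\|$ for all $x_1,x_2\in\Omega$ and $\mathbb P_X(0<|\eta(X)-\tfrac12|<t)\le M t^{\alpha}$ for all $t>0$; - $\mathcal P_{\mathcal T,\psi}$ is the set of laws with $\mathbb P_X(\mu(X)<\varepsilon)\le\psi(\varepsilon)$ for all $0<\varepsilon<\varepsilon_0$; - $\mathfrak M(\kappa)$ is the set of laws with $\mathbb P_X(B(x,\delta))\ge\kappa\,\mu(x)\,\delta^d$ for all $x\in\Omega$ and $0<\delta\le\delta_0$. Let $\mathcal G=\mathcal F_{L,\alpha}\cap\mathcal P_{\mathcal T,\psi}\cap\mathfrak M(\kappa)$. Given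 an i.i.d. sample $\mathcal S_n=(X_i,Y_i)_{i\le n}$ of law $\mathbb P_{X,Y}$ and an independent new observation $(X,Y)$ of the same law, let $\mathcal R(\Phi_n)=\mathbb P(\Phi_n(X)\ne Y)$ (probability over the sample and the new observation) for a classifier $\Phi_n$ that is a measurable function of $\mathcal S_n$ and $X$, and let $\Phi^*=\mathbf 1_{\{\eta>1/2\}}$ be the Bayes classifier. The $k$-nearest neighbor rule $\Phi_{n,k}$ answers $1$ at $x$ if and only if $\frac1k\sum_{j\le k}Y_{(j)}(x)>\frac12$, where $Y_{(j)}(x)$ is the label of the $j$-th sample point in the order of increasing distance to $x$. There is a constant $\kappa_d>0$, depending only on $d$, such that the following holds for all $\alpha,L,M>0$ and for every $\psi$ that is strictly increasing on some interval $(0,r)$ with $\psi(\varepsilon)\to0$ as $\varepsilon\to0^+$. Let $\psi^{-1}(y)=\inf\{t\in(0,r):\psi(t)\ge y\}$ (the inverse of $\psi|_{(0,r)}$, generalized in case $\psi$ jumps). (i) Lower bound. If $\alpha>d$, assume moreover that $\psi^{-1}(\varepsilon^{\alpha})=o(\varepsilon^{\alpha-d})$ as $\varepsilon\to0^+$ (for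 instance $\psi(\varepsilon)\ge c_0\,\varepsilon$ near $0$ for some $c_0>0$); no such condition is needed if $\alpha\le d$. Then for every $0<\kappa\le\kappa_d$ and every $\delta_0>0$, if $\varepsilon_0$ is small enough, there is a constant $c>0$, independent of $n$, such that for every $n\ge1$ and every $\varepsilon_n>0$ with $n^{-1}=\varepsilon_n^{2+d}\,\psi^{-1}(\varepsilon_n^{\alpha})$, $$\inf_{\Phi_n}\ \sup_{\mathbb P_{X,Y}\in\mathcal G}\big[\mathcal R(\Phi_n)-\mathcal R(\Phi^*)\big]\ \ge\ c\,\varepsilon_n^{1+\alpha}.$$ (ii) Upper bound. For all $\kappa,\delta_0,\varepsilon_0>0$ there is a constant $C>0$, independent of $n$, such that for every $n\ge1$ and every $\nu_n>0$ with $n^{-1}=\nu_n^{2+d}\,\psi^{-1}(\nu_n^{1+\alpha})$, the nearest neighbor rule with $k_n=\lfloor\nu_n^{-2}\rfloor$ satisfies $$\sup_{\mathbb P_{X,Y}\in\mathcal G}\big[\mathcal R(\Phi_{n,k_n})-\mathcal R(\Phi^*)\big]\ \le\ C\,\nu_n^{1+\alpha}.$$ -/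

import Mathlib

open MeasureTheory Set Filter Topology

noncomputable section

/-- A binary classification model on `ℝ^d`: a probability density `μ` of the input `X`, whose
support `{μ > 0}` is open, and a regression function `η` with values in `[0, 1]`. -/
structure ClassifModel (d : ℕ) where
  μ : EuclideanSpace ℝ (Fin d) → ℝ
  η : EuclideanSpace ℝ (Fin d) → ℝ
  measurable_μ : Measurable μ
  measurable_η : Measurable η
  μ_nonneg : ∀ x, 0 ≤ μ x
  lintegral_μ : ∫⁻ x, ENNReal.ofReal (μ x) = 1
  η_mem : ∀ x, η x ∈ Icc (0 : ℝ) 1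
  isOpen_support : IsOpen (Function.support μ)

namespace ClassifModel

variable {d : ℕ}

/-- The set `Ω` on which the density is positive. -/
def Ω (P : ClassifModel d) : Set (EuclideanSpace ℝ (Fin d)) := Function.support P.μ

/-- The law of the input `X`, with density `μ` with respect to Lebesgue measure. -/
def marginal (P : ClassifModel d) : Measure (EuclideanSpace ℝ (Fin d)) :=
  volume.withDensity (fun x => ENNReal.ofReal (P.μ x))

/-- The law of `(X, Y)`: the input `X` has density `μ` and, given `X = x`, the label `Y` is a
Bernoulli variable of parameter `η x`; the labels `1` and `0` are `true` and `false`. -/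
def law (P : ClassifModel d) : Measure (EuclideanSpace ℝ (Fin d) × Bool) :=
  (P.marginal.withDensity (fun x => ENNReal.ofReal (P.η x))).map (fun x => (x, true)) +
    (P.marginal.withDensity (fun x => ENNReal.ofReal (1 - P.η x))).map (fun x => (x, false))

instance (P : ClassifModel d) : IsProbabilityMeasure P.marginal :=
  ⟨by simpa [marginal] using P.lintegral_μ⟩

/-- The first marginal of the law of `(X, Y)` is the law of `X`. -/
theorem map_fst_law (P : ClassifModel d) : P.law.map Prod.fst = P.marginal := by
  rw [law, Measure.map_add _ _ measurable_fst,
    Measure.map_map measurable_fst (by fun_prop), Measure.map_map measurable_fst (by fun_prop)]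
  have h : ∀ b : Bool, (Prod.fst ∘ fun x : EuclideanSpace ℝ (Fin d) => (x, b)) = id :=
    fun b => rfl
  rw [h, h, Measure.map_id, Measure.map_id,
    ← withDensity_add_left P.measurable_η.ennreal_ofReal]
  have h1 : ((fun x => ENNReal.ofReal (P.η x)) + fun x => ENNReal.ofReal (1 - P.η x)) = 1 := by
    funext x
    have := P.η_mem x
    simp only [Pi.add_apply, Pi.one_apply]
    rw [← ENNReal.ofReal_add this.1 (by linarith [this.2])]
    simp
  rw [h1, withDensity_one]

instance (P : ClassifModel d) : IsProbabilityMeasure P.law := by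
  constructor
  have h := congrArg (fun m : Measure _ => m univ) P.map_fst_law
  simpa [Measure.map_apply measurable_fst] using h

/-- The Bayes classifier, the indicator of `{η > 1/2}`. -/
def bayes (P : ClassifModel d) (x : EuclideanSpace ℝ (Fin d)) : Bool :=
  decide (1 / 2 < P.η x)

/-- The misclassification probability of a classifier that does not use a sample. -/
def risk (P : ClassifModel d) (Φ : EuclideanSpace ℝ (Fin d) → Bool) : ℝ :=
  P.law.real {z | Φ z.1 ≠ z.2}

/-- The misclassification probability `ℙ(Φₙ(X) ≠ Y)` of a classifier built on an i.i.d. sample of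
size `n`, where `(X, Y)` is a new observation, independent of the sample; the probability is taken
over the sample and the new observation. -/
def sampleRisk (P : ClassifModel d) {n : ℕ}
    (Φ : (Fin n → EuclideanSpace ℝ (Fin d) × Bool) → EuclideanSpace ℝ (Fin d) → Bool) : ℝ :=
  (P.law.prod (Measure.pi fun _ : Fin n => P.law)).real {w | Φ w.2 w.1.1 ≠ w.1.2}

/-- The excess risk `R(Φₙ) - R(Φ*)`. -/
def excessRisk (P : ClassifModel d) {n : ℕ}
    (Φ : (Fin n → EuclideanSpace ℝ (Fin d) × Bool) → EuclideanSpace ℝ (Fin d) → Bool) : ℝ :=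
  P.sampleRisk Φ - P.risk P.bayes

end ClassifModel

/-- Smoothness (radius `L`) and margin (exponent `α`, constant `M`). -/
def smoothMarginClass (d : ℕ) (L α M : ℝ) : Set (ClassifModel d) :=
  {P | (∀ x₁ ∈ P.Ω, ∀ x₂ ∈ P.Ω, |P.η x₁ - P.η x₂| ≤ L * ‖x₁ - x₂‖) ∧
    ∀ t : ℝ, 0 < t →
      P.marginal.real {x | 0 < |P.η x - 1 / 2| ∧ |P.η x - 1 / 2| < t} ≤ M * t ^ α}

/-- Strong minimal mass (constant `κ`, radii up to `δ₀`). -/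
def minimalMassClass (d : ℕ) (κ δ₀ : ℝ) : Set (ClassifModel d) :=
  {P | ∀ δ : ℝ, 0 < δ → δ ≤ δ₀ → ∀ x ∈ P.Ω,
    κ * P.μ x * δ ^ d ≤ P.marginal.real (Metric.ball x δ)}

/-- Tail assumption driven by `ψ` (levels below `ε₀`). -/
def tailClass (d : ℕ) (ψ : ℝ → ℝ) (ε₀ : ℝ) : Set (ClassifModel d) :=
  {P | ∀ ε : ℝ, 0 < ε → ε < ε₀ → P.marginal.real {x | P.μ x < ε} ≤ ψ ε}

/-- The minimax excess risk over a class of models: infimum over all classifiers that are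
measurable functions of the sample and of the new input. -/
def minimaxRisk {d : ℕ} (n : ℕ) (𝓕 : Set (ClassifModel d)) : ENNReal :=
  ⨅ Φ : {Φ : (Fin n → EuclideanSpace ℝ (Fin d) × Bool) → EuclideanSpace ℝ (Fin d) → Bool //
      Measurable (Function.uncurry Φ)},
    ⨆ P ∈ 𝓕, ENNReal.ofReal (P.excessRisk Φ.1)

/-- The `k`-nearest neighbor classifier. The permutation `Tuple.sort` reorders the sample by
increasing distance to `x`, ties being broken by the index; the rule answers `1` when the average
of the labels of the first `k` points of the reordered sample exceeds `1/2`. -/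
def knnClassifier {d : ℕ} (n k : ℕ) (S : Fin n → EuclideanSpace ℝ (Fin d) × Bool)
    (x : EuclideanSpace ℝ (Fin d)) : Bool :=
  let σ : Equiv.Perm (Fin n) := Tuple.sort fun i => ‖(S i).1 - x‖
  decide ((1 / 2 : ℝ) <
    1 / (k : ℝ) * ∑ j : Fin n, if (j : ℕ) < k ∧ (S (σ j)).2 = true then (1 : ℝ) else 0)

/-- The (generalized) inverse of a function that increases strictly on `(0, r)`. -/
def tailInv (ψ : ℝ → ℝ) (r y : ℝ) : ℝ := sInf {t : ℝ | 0 < t ∧ t < r ∧ y ≤ ψ t}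

/-- On the values of `ψ` the generalized inverse is the inverse function. -/
theorem tailInv_apply {ψ : ℝ → ℝ} {r t : ℝ} (hψ : StrictMonoOn ψ (Ioo 0 r)) (ht : t ∈ Ioo 0 r) :
    tailInv ψ r (ψ t) = t := by
  have h : IsLeast {s : ℝ | 0 < s ∧ s < r ∧ ψ t ≤ ψ s} t :=
    ⟨⟨ht.1, ht.2, le_rfl⟩, fun s hs => (hψ.le_iff_le ht ⟨hs.1, hs.2.1⟩).1 hs.2.2⟩
  exact h.csInf_eq

/-- The positive number `ε` solves `1/n = ε ^ (2 + d) * ψ⁻¹ (ε ^ β)`. -/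
def SolvesBalance (d : ℕ) (ψ : ℝ → ℝ) (r β : ℝ) (n : ℕ) (ε : ℝ) : Prop :=
  0 < ε ∧ (n : ℝ)⁻¹ = ε ^ (2 + d) * tailInv ψ r (ε ^ β)

end

/-! Both bounds rest on `excessRisk_eq`: the excess risk is the integral of |2η - 1| against the
probability that the rule contradicts the Bayes label at the new input.

Upper bound. Let t = ψ⁻¹(ν^(1+α)). Points of density below t/2 have mass at most ν^(1+α) and are
given up. Around any other point x, the ball of radius aν contains k sample points except with
probability exp(-ν⁻²/2). If Δ = |η(x) - 1/2| is at least 2Laν, the Lipschitz condition makes the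
Bayes label of x the likelier one throughout that ball, and a Chernoff bound for the k labels,
independent given the inputs, bounds the error by exp(-Δ²/(4ν²)); for smaller Δ a constant factor
makes this bound trivial (`disagree_knnClassifier_le`, `disagree_knn_le_of_mem`). The margin
condition, applied in layers of width ν, integrates it to a multiple of ν^(1+α)
(`integral_margin_le`).

Lower bound. This is Assouad's hypercube argument. A grid of cells of radius ε and density t =
ψ⁻¹(ε^α) has total mass of order ε^α; η equals 1/2 ± cε on each cell, and a ball of high density
next to the grid takes the remaining mass. Since n ε^(2+d) t ≤ 1, a sample cannot reveal the sign of
a single cell (`half_le_error_add_error`), and averaging over all signs produces an excess risk of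
order ε · ε^α (`exists_excessRisk_ge`). The tail condition holds since ψ is at least ε^α above t. At
least one cell has to fit, that is, t must be at most of order ε^(α-d): the extra hypothesis for α >
d serves only this. The delicate membership is strong minimal mass
(`gridDesign_mem_minimalMassClass`): as a ball around a point of a cell grows, it captures part of a
cell, then a block of cells, then part of the heavy ball. -/

/-! ### Product measures with densities. -/

/-- The integral of a product of functions of the separate coordinates. -/
theorem lintegral_pi_prod {ι : Type*} [Fintype ι] {X : ι → Type*} [∀ i, MeasurableSpace (X i)]
    (μ : ∀ i, Measure (X i)) [∀ i, IsProbabilityMeasure (μ i)]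
    (f : ∀ i, X i → ENNReal) (hf : ∀ i, Measurable (f i)) :
    ∫⁻ x, ∏ i, f i (x i) ∂Measure.pi μ = ∏ i, ∫⁻ x, f i x ∂μ i := by
  have hind : ProbabilityTheory.iIndepFun (fun i (x : ∀ i, X i) => f i (x i)) (Measure.pi μ) :=
    ProbabilityTheory.iIndepFun_pi (X := fun i => f i) fun i => (hf i).aemeasurable
  have h := ProbabilityTheory.lintegral_prod_eq_prod_lintegral_of_indepFun Finset.univ
    (fun i (x : ∀ i, X i) => f i (x i)) hind (fun i => (hf i).comp (measurable_pi_apply i))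
  rw [h]
  refine Finset.prod_congr rfl fun i _ => ?_
  exact (measurePreserving_eval μ i).lintegral_comp (hf i)

/-- A product of measures with densities has the product density. -/
theorem pi_withDensity {ι : Type*} [Fintype ι] {X : ι → Type*} [∀ i, MeasurableSpace (X i)]
    (μ : ∀ i, Measure (X i)) [∀ i, IsProbabilityMeasure (μ i)]
    (f : ∀ i, X i → ENNReal) (hf : ∀ i, Measurable (f i))
    [∀ i, SigmaFinite ((μ i).withDensity (f i))] :
    Measure.pi (fun i => (μ i).withDensity (f i)) =
      (Measure.pi μ).withDensity (fun x => ∏ i, f i (x i)) := by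
  refine Measure.pi_eq (μ := fun i => (μ i).withDensity (f i)) fun s hs => ?_
  rw [withDensity_apply _ (MeasurableSet.univ_pi hs),
    ← lintegral_indicator (MeasurableSet.univ_pi hs)]
  have h : ((univ : Set ι).pi s).indicator (fun x : ∀ i, X i => ∏ i, f i (x i)) =
      fun x => ∏ i, (s i).indicator (f i) (x i) := by
    funext x
    by_cases hx : x ∈ (univ : Set ι).pi s
    · rw [indicator_of_mem hx]
      exact Finset.prod_congr rfl fun i _ => (indicator_of_mem (hx i (mem_univ i)) _).symm
    · rw [indicator_of_notMem hx]
      simp only [mem_univ_pi, not_forall] at hx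
      obtain ⟨i, hi⟩ := hx
      exact (Finset.prod_eq_zero (Finset.mem_univ i) (indicator_of_notMem hi _)).symm
  rw [h, lintegral_pi_prod μ _ fun i => (hf i).indicator (hs i)]
  refine Finset.prod_congr rfl fun i _ => ?_
  rw [withDensity_apply _ (hs i), lintegral_indicator (hs i)]

/-! ### The excess risk as a weighted probability of disagreement. -/

namespace ClassifModel

variable {d : ℕ}

theorem lintegral_law (P : ClassifModel d) {f : EuclideanSpace ℝ (Fin d) × Bool → ENNReal}
    (hf : Measurable f) :
    ∫⁻ z, f z ∂P.law = ∫⁻ x, (ENNReal.ofReal (P.η x) * f (x, true) +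
      ENNReal.ofReal (1 - P.η x) * f (x, false)) ∂P.marginal := by
  have hη := P.measurable_η
  rw [law, lintegral_add_measure, lintegral_map hf (by fun_prop), lintegral_map hf (by fun_prop),
    lintegral_withDensity_eq_lintegral_mul _ (by fun_prop) (by fun_prop),
    lintegral_withDensity_eq_lintegral_mul _ (by fun_prop) (by fun_prop),
    ← lintegral_add_left (by fun_prop)]
  rfl

theorem integral_law (P : ClassifModel d) {f : EuclideanSpace ℝ (Fin d) × Bool → ℝ}
    (hf : Measurable f) (h0 : ∀ z, 0 ≤ f z) :
    ∫ z, f z ∂P.law = ∫ x, (P.η x * f (x, true) + (1 - P.η x) * f (x, false)) ∂P.marginal := by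
  have hη := P.measurable_η
  rw [integral_eq_lintegral_of_nonneg_ae (ae_of_all _ h0) hf.aestronglyMeasurable,
    integral_eq_lintegral_of_nonneg_ae (ae_of_all _ fun x => ?_)
      (Measurable.aestronglyMeasurable (by fun_prop)), lintegral_law P (by fun_prop)]
  · congr 1
    refine lintegral_congr fun x => ?_
    have := P.η_mem x
    rw [ENNReal.ofReal_add (mul_nonneg this.1 (h0 _))
      (mul_nonneg (by linarith [this.2]) (h0 _)), ENNReal.ofReal_mul this.1,
      ENNReal.ofReal_mul (by linarith [this.2])]
  · have := P.η_mem x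
    exact add_nonneg (mul_nonneg this.1 (h0 _)) (mul_nonneg (by linarith [this.2]) (h0 _))

/-- The probability, over the sample, that a classifier disagrees with the Bayes rule at `x`. -/
noncomputable def disagree (P : ClassifModel d) {n : ℕ}
    (Φ : (Fin n → EuclideanSpace ℝ (Fin d) × Bool) → EuclideanSpace ℝ (Fin d) → Bool)
    (x : EuclideanSpace ℝ (Fin d)) : ℝ :=
  (Measure.pi fun _ : Fin n => P.law).real {S | Φ S x ≠ P.bayes x}

theorem disagree_nonneg (P : ClassifModel d) {n : ℕ}
    (Φ : (Fin n → EuclideanSpace ℝ (Fin d) × Bool) → EuclideanSpace ℝ (Fin d) → Bool)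
    (x : EuclideanSpace ℝ (Fin d)) : 0 ≤ P.disagree Φ x := measureReal_nonneg

theorem disagree_le_one (P : ClassifModel d) {n : ℕ}
    (Φ : (Fin n → EuclideanSpace ℝ (Fin d) × Bool) → EuclideanSpace ℝ (Fin d) → Bool)
    (x : EuclideanSpace ℝ (Fin d)) : P.disagree Φ x ≤ 1 := measureReal_le_one

theorem bayes_eq_true (P : ClassifModel d) {x : EuclideanSpace ℝ (Fin d)} (h : 1 / 2 < P.η x) :
    P.bayes x = true := decide_eq_true h

theorem bayes_eq_false (P : ClassifModel d) {x : EuclideanSpace ℝ (Fin d)} (h : P.η x ≤ 1 / 2) :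
    P.bayes x = false := decide_eq_false (not_lt.2 h)

theorem measurable_bayes (P : ClassifModel d) : Measurable P.bayes := by
  have h : MeasurableSet {x | 1 / 2 < P.η x} :=
    measurableSet_lt measurable_const P.measurable_η
  refine measurable_to_bool ?_
  convert h using 1
  ext x
  simp [bayes]

theorem measurable_disagree (P : ClassifModel d) {n : ℕ}
    {Φ : (Fin n → EuclideanSpace ℝ (Fin d) × Bool) → EuclideanSpace ℝ (Fin d) → Bool}
    (hΦ : Measurable (Function.uncurry Φ)) : Measurable (P.disagree Φ) := by
  have hm : MeasurableSet {w : EuclideanSpace ℝ (Fin d) ×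
      (Fin n → EuclideanSpace ℝ (Fin d) × Bool) | Φ w.2 w.1 ≠ P.bayes w.1} :=
    (measurableSet_eq_fun (hΦ.comp measurable_swap)
      (P.measurable_bayes.comp measurable_fst)).compl
  exact (measurable_measure_prodMk_left (ν := Measure.pi fun _ : Fin n => P.law)
    hm).ennreal_toReal

/-- The excess risk, as an integral over the new input. -/
theorem excessRisk_eq (P : ClassifModel d) {n : ℕ}
    {Φ : (Fin n → EuclideanSpace ℝ (Fin d) × Bool) → EuclideanSpace ℝ (Fin d) → Bool}
    (hΦ : Measurable (Function.uncurry Φ)) :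
    P.excessRisk Φ = ∫ x, |2 * P.η x - 1| * P.disagree Φ x ∂P.marginal := by
  have hη := P.measurable_η
  set ν := Measure.pi fun _ : Fin n => P.law with hν
  have hm : MeasurableSet {w : (EuclideanSpace ℝ (Fin d) × Bool) ×
      (Fin n → EuclideanSpace ℝ (Fin d) × Bool) | Φ w.2 w.1.1 ≠ w.1.2} :=
    (measurableSet_eq_fun (f := fun w : (EuclideanSpace ℝ (Fin d) × Bool) ×
      (Fin n → EuclideanSpace ℝ (Fin d) × Bool) => Φ w.2 w.1.1)
      (hΦ.comp (measurable_snd.prodMk (measurable_fst.comp measurable_fst)))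
      (measurable_snd.comp measurable_fst)).compl
  have hq : Measurable fun z : EuclideanSpace ℝ (Fin d) × Bool => ν.real {S | Φ S z.1 ≠ z.2} :=
    (measurable_measure_prodMk_left (ν := ν) hm).ennreal_toReal
  have hcompl : ∀ x, ν.real {S | Φ S x ≠ false} = 1 - ν.real {S | Φ S x ≠ true} := by
    intro x
    have hs : MeasurableSet {S | Φ S x ≠ true} :=
      (measurableSet_eq_fun (f := fun S => Φ S x) (hΦ.comp (measurable_id.prodMk measurable_const))
        measurable_const).compl
    rw [← probReal_compl_eq_one_sub hs]
    congr 1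
    ext S
    simp
  have hS : P.sampleRisk Φ = ∫ x, (P.η x * ν.real {S | Φ S x ≠ true} +
      (1 - P.η x) * ν.real {S | Φ S x ≠ false}) ∂P.marginal := by
    rw [← integral_law P (f := fun z => ν.real {S | Φ S z.1 ≠ z.2}) hq
      fun _ => measureReal_nonneg]
    rw [sampleRisk, measureReal_def, Measure.prod_apply hm]
    symm
    exact integral_toReal (measurable_measure_prodMk_left (ν := ν) hm).aemeasurable
      (ae_of_all _ fun z => measure_lt_top _ _)
  have hmb : MeasurableSet {z : EuclideanSpace ℝ (Fin d) × Bool | P.bayes z.1 ≠ z.2} :=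
    (measurableSet_eq_fun (P.measurable_bayes.comp measurable_fst) measurable_snd).compl
  have hB : P.risk P.bayes = ∫ x, (P.η x * (if P.bayes x ≠ true then 1 else 0) +
      (1 - P.η x) * (if P.bayes x ≠ false then 1 else 0)) ∂P.marginal := by
    have h1 := integral_law P
      (f := {z : EuclideanSpace ℝ (Fin d) × Bool | P.bayes z.1 ≠ z.2}.indicator 1)
      (measurable_one.indicator hmb) (fun z => indicator_nonneg (fun _ _ => zero_le_one) z)
    rw [integral_indicator_one hmb] at h1
    rw [risk, h1]
    refine integral_congr_ae (ae_of_all _ fun x => ?_)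
    simp [indicator]
  have hb : Measurable fun x => P.η x * ν.real {S | Φ S x ≠ true} +
      (1 - P.η x) * ν.real {S | Φ S x ≠ false} := by
    have h1 := hq.comp (measurable_prodMk_right (y := true))
    have h2 := hq.comp (measurable_prodMk_right (y := false))
    exact (hη.mul h1).add ((measurable_const.sub hη).mul h2)
  have hb' : Measurable fun x => P.η x * (if P.bayes x ≠ true then (1 : ℝ) else 0) +
      (1 - P.η x) * (if P.bayes x ≠ false then 1 else 0) := by
    have hc : ∀ b, MeasurableSet {x | P.bayes x ≠ b} := fun b =>
      (measurableSet_eq_fun P.measurable_bayes measurable_const).compl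
    exact (hη.mul (Measurable.ite (hc _) measurable_const measurable_const)).add
      ((measurable_const.sub hη).mul (Measurable.ite (hc _) measurable_const measurable_const))
  rw [excessRisk, hS, hB, ← integral_sub]
  · refine integral_congr_ae (ae_of_all _ fun x => ?_)
    have := P.η_mem x
    simp only [hcompl]
    by_cases h : 1 / 2 < P.η x
    · have hbx : P.bayes x = true := P.bayes_eq_true h
      simp only [disagree, hbx]
      rw [abs_of_nonneg (by linarith)]
      simp only [ne_eq, not_true_eq_false, if_false, Bool.true_eq_false, not_false_eq_true, if_true]
      ring
    · have hbx : P.bayes x = false := P.bayes_eq_false (not_lt.1 h)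
      have h' := hcompl x
      simp only [disagree, hbx, ← hν, h']
      rw [abs_of_nonpos (by linarith)]
      simp only [ne_eq, not_true_eq_false, if_false, Bool.false_eq_true, not_false_eq_true, if_true]
      ring
  · refine Integrable.of_bound (C := 2) hb.aestronglyMeasurable (ae_of_all _ fun x => ?_)
    have := P.η_mem x
    have h1 : ν.real {S | Φ S x ≠ true} ≤ 1 := measureReal_le_one
    have h2 : ν.real {S | Φ S x ≠ false} ≤ 1 := measureReal_le_one
    have h3 : 0 ≤ ν.real {S | Φ S x ≠ true} := measureReal_nonneg
    have h4 : 0 ≤ ν.real {S | Φ S x ≠ false} := measureReal_nonneg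
    rw [Real.norm_eq_abs, abs_le]
    constructor <;> nlinarith [this.1, this.2]
  · refine Integrable.of_bound (C := 2) hb'.aestronglyMeasurable (ae_of_all _ fun x => ?_)
    have := P.η_mem x
    rw [Real.norm_eq_abs, abs_le]
    constructor <;> split_ifs <;> linarith [this.1, this.2]

end ClassifModel

/-! ### Nearest neighbors: order statistics and measurability. -/

/-- The indices of the `k` points nearest to `x`, in the order used by `knnClassifier`. -/
noncomputable def nearestIndices {d n : ℕ} (k : ℕ) (X : Fin n → EuclideanSpace ℝ (Fin d))
    (x : EuclideanSpace ℝ (Fin d)) : Finset (Fin n) :=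
  (Finset.univ.filter fun j : Fin n => (j : ℕ) < k).map
    (Tuple.sort fun i => ‖X i - x‖).toEmbedding

theorem card_nearestIndices {d n k : ℕ} (hk : k ≤ n) (X : Fin n → EuclideanSpace ℝ (Fin d))
    (x : EuclideanSpace ℝ (Fin d)) : (nearestIndices k X x).card = k := by
  rw [nearestIndices, Finset.card_map, Fin.card_filter_val_lt, min_eq_right hk]

theorem knnClassifier_eq {d n k : ℕ} (S : Fin n → EuclideanSpace ℝ (Fin d) × Bool)
    (x : EuclideanSpace ℝ (Fin d)) :
    knnClassifier n k S x = decide ((1 / 2 : ℝ) < 1 / (k : ℝ) *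
      ∑ i ∈ nearestIndices k (fun i => (S i).1) x, if (S i).2 = true then (1 : ℝ) else 0) := by
  rw [knnClassifier, nearestIndices, Finset.sum_map, Finset.sum_filter]
  simp only [ite_and, Equiv.coe_toEmbedding]

/-- Finitely many comparisons of coordinates decide which permutation the sort returns, ties
included. -/
theorem measurableSet_sort_eq {Z : Type*} [MeasurableSpace Z] {n : ℕ} {f : Z → Fin n → ℝ}
    (hf : ∀ i, Measurable fun z => f z i) (σ : Equiv.Perm (Fin n)) :
    MeasurableSet {z | Tuple.sort (f z) = σ} := by
  have h : {z | Tuple.sort (f z) = σ} =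
      (⋂ i, ⋂ j, {z | i ≤ j → f z (σ i) ≤ f z (σ j)}) ∩
        ⋂ i, ⋂ j, {z | i < j → f z (σ i) = f z (σ j) → σ i < σ j} := by
    ext z
    simp only [mem_ofPred_eq, mem_inter_iff, mem_iInter]
    rw [eq_comm, Tuple.eq_sort_iff]
    rfl
  rw [h]
  refine (MeasurableSet.iInter fun i => MeasurableSet.iInter fun j => ?_).inter
    (MeasurableSet.iInter fun i => MeasurableSet.iInter fun j => ?_)
  · exact MeasurableSet.imp (MeasurableSet.const _) (measurableSet_le (hf _) (hf _))
  · exact MeasurableSet.imp (MeasurableSet.const _)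
      (MeasurableSet.imp (measurableSet_eq_fun (hf _) (hf _)) (MeasurableSet.const _))

theorem measurableSet_nearestIndices_eq {Z : Type*} [MeasurableSpace Z] {d n : ℕ} (k : ℕ)
    {X : Z → Fin n → EuclideanSpace ℝ (Fin d)} {x : Z → EuclideanSpace ℝ (Fin d)}
    (hX : ∀ i, Measurable fun z => X z i) (hx : Measurable x) (A : Finset (Fin n)) :
    MeasurableSet {z | nearestIndices k (X z) (x z) = A} := by
  have h : {z | nearestIndices k (X z) (x z) = A} =
      ⋃ σ : Equiv.Perm (Fin n), {z | Tuple.sort (fun i => ‖X z i - x z‖) = σ} ∩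
        {_z | (Finset.univ.filter fun j : Fin n => (j : ℕ) < k).map σ.toEmbedding = A} := by
    ext z
    simp only [nearestIndices, mem_ofPred_eq, mem_iUnion, mem_inter_iff, exists_eq_left']
  rw [h]
  exact MeasurableSet.iUnion fun σ =>
    (measurableSet_sort_eq (fun i => ((hX i).sub hx).norm) σ).inter (MeasurableSet.const _)

theorem measurable_knnClassifier (d n k : ℕ) :
    Measurable (Function.uncurry (knnClassifier (d := d) n k)) := by
  refine measurable_to_bool ?_
  have h : (Function.uncurry (knnClassifier (d := d) n k)) ⁻¹' {true} =
      ⋃ A : Finset (Fin n), {z | nearestIndices k (fun i => (z.1 i).1) z.2 = A} ∩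
        {z | (1 / 2 : ℝ) < 1 / (k : ℝ) * ∑ i ∈ A, if (z.1 i).2 = true then (1 : ℝ) else 0} := by
    ext z
    simp only [mem_preimage, Function.uncurry, mem_singleton_iff, knnClassifier_eq,
      decide_eq_true_eq, mem_iUnion, mem_inter_iff, mem_ofPred_eq, exists_eq_left']
  rw [h]
  refine MeasurableSet.iUnion fun A => (measurableSet_nearestIndices_eq k (fun i => ?_)
    measurable_snd A).inter (measurableSet_lt measurable_const (Measurable.const_mul
      (Finset.measurable_sum _ fun i _ => Measurable.ite ?_ measurable_const measurable_const) _))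
  · fun_prop
  · have : Measurable fun z : (Fin n → EuclideanSpace ℝ (Fin d) × Bool) ×
        EuclideanSpace ℝ (Fin d) => (z.1 i).2 := by fun_prop
    exact this (measurableSet_singleton true)

/-- If at least `k` sample points lie in a ball, the `k` nearest ones do. -/
theorem norm_lt_of_mem_nearestIndices {d n k : ℕ} {X : Fin n → EuclideanSpace ℝ (Fin d)}
    {x : EuclideanSpace ℝ (Fin d)} {δ : ℝ}
    (h : k ≤ (Finset.univ.filter fun i => ‖X i - x‖ < δ).card) {i : Fin n}
    (hi : i ∈ nearestIndices k X x) : ‖X i - x‖ < δ := by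
  simp only [nearestIndices, Finset.mem_map, Finset.mem_filter, Finset.mem_univ, true_and,
    Equiv.coe_toEmbedding] at hi
  obtain ⟨j, hj, rfl⟩ := hi
  by_contra hc
  have hmono := Tuple.monotone_sort fun i => ‖X i - x‖
  -- If the point of rank j < k is at distance at least δ, every point closer than δ has rank below
  -- j, so there are fewer than k of them.
  have hsub : (Finset.univ.filter fun i => ‖X i - x‖ < δ) ⊆
      nearestIndices j X x := by
    intro i hi
    simp only [Finset.mem_filter, Finset.mem_univ, true_and] at hi
    simp only [nearestIndices, Finset.mem_map, Finset.mem_filter, Finset.mem_univ, true_and,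
      Equiv.coe_toEmbedding]
    refine ⟨(Tuple.sort fun i => ‖X i - x‖).symm i, ?_, by simp⟩
    by_contra hl
    have := hmono (Fin.le_def.2 (not_lt.1 hl))
    simp only [Function.comp, Equiv.apply_symm_apply] at this
    exact hc (this.trans_lt hi)
  have := Finset.card_le_card hsub
  rw [card_nearestIndices j.2.le] at this
  omega

/-! ### Chernoff bounds and the pointwise error of the nearest neighbor rule. -/

/-- A lower tail bound for the number of points of an i.i.d. sample in a given set. -/
theorem measureReal_card_lt_le {X : Type*} [MeasurableSpace X] (μ : Measure X)
    [IsProbabilityMeasure μ] {B : Set X} (hB : MeasurableSet B) [DecidablePred (· ∈ B)]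
    (n k : ℕ) :
    (Measure.pi fun _ : Fin n => μ).real
      {S | (Finset.univ.filter fun i => S i ∈ B).card < k} ≤ Real.exp (k - n * μ.real B / 2) := by
  -- Exponential Markov inequality for minus the count: one point contributes 1 - (1 - e⁻¹)p ≤
  -- exp(-p/2), with p the mass of B.
  obtain ⟨g, hg⟩ : ∃ g : X → ℝ, g = fun x => Real.exp (-(if x ∈ B then 1 else 0)) := ⟨_, rfl⟩
  have hg0 : ∀ x, 0 < g x := fun x => by rw [hg]; exact Real.exp_pos _
  have hgm : Measurable g := by
    rw [hg]
    exact
    Real.measurable_exp.comp (Measurable.ite hB measurable_const measurable_const).neg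
  have hN : ∀ S : Fin n → X, ∏ i, g (S i) =
      Real.exp (-((Finset.univ.filter fun i => S i ∈ B).card : ℝ)) := by
    intro S
    rw [hg, ← Real.exp_sum, Finset.sum_neg_distrib, Finset.sum_boole]
  have hm : Measurable fun S : Fin n → X => ∏ i, g (S i) :=
    Finset.measurable_prod _ fun i _ => hgm.comp (measurable_pi_apply i)
  have hi : Integrable (fun S : Fin n → X => ∏ i, g (S i)) (Measure.pi fun _ : Fin n => μ) := by
    refine Integrable.of_bound (C := 1) hm.aestronglyMeasurable (ae_of_all _ fun S => ?_)
    rw [hN, Real.norm_eq_abs, abs_of_pos (Real.exp_pos _)]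
    exact Real.exp_le_one_iff.2 (by simp)
  have h1 : ∫ x, g x ∂μ ≤ Real.exp (-(μ.real B / 2)) := by
    have : g = fun x => 1 - (1 - Real.exp (-1)) * B.indicator 1 x := by
      funext x
      by_cases hx : x ∈ B <;> simp [hg, hx]
    rw [this, integral_sub (integrable_const _)
      (((integrable_indicator_iff hB).2 (integrable_const _).integrableOn).const_mul _),
      integral_const_mul, integral_indicator_one hB]
    simp only [integral_const, probReal_univ, smul_eq_mul, mul_one]
    have he : Real.exp (-1) ≤ 1 / 2 := by
      rw [Real.exp_neg, one_div]
      exact inv_anti₀ two_pos (by linarith [Real.add_one_le_exp (1 : ℝ)])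
    have h0 : 0 ≤ μ.real B := measureReal_nonneg
    nlinarith [Real.add_one_le_exp (-(μ.real B / 2))]
  have h2 : {S : Fin n → X | (Finset.univ.filter fun i => S i ∈ B).card < k} ⊆
      {S | Real.exp (-k) ≤ ∏ i, g (S i)} := by
    intro S hS
    simp only [mem_ofPred_eq] at hS ⊢
    rw [hN]
    exact Real.exp_le_exp.2 (neg_le_neg (by exact_mod_cast hS.le))
  have h3 := mul_meas_ge_le_integral_of_nonneg
    (ae_of_all _ fun S : Fin n → X => Finset.prod_nonneg fun i _ => (hg0 _).le) hi
    (Real.exp (-k))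
  rw [integral_fintype_prod_eq_pow, Fintype.card_fin] at h3
  have h4 := measureReal_mono h2 (measure_ne_top (Measure.pi fun _ : Fin n => μ) _)
  have h5 : (∫ x, g x ∂μ) ^ n ≤ Real.exp (-(n * μ.real B / 2)) := by
    refine (pow_le_pow_left₀ (integral_nonneg fun x => (hg0 _).le) h1 n).trans_eq ?_
    rw [← Real.exp_nat_mul]
    ring_nf
  rw [sub_eq_add_neg, Real.exp_add]
  refine h4.trans ?_
  have h6 := mul_le_mul_of_nonneg_left h3 (Real.exp_pos (k : ℝ)).le
  rw [← mul_assoc, ← Real.exp_add, add_neg_cancel, Real.exp_zero, one_mul] at h6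
  exact h6.trans (mul_le_mul_of_nonneg_left h5 (Real.exp_pos _).le)

namespace ClassifModel

variable {d : ℕ}

/-- This takes the place of conditioning on the inputs: the label is integrated out of a weight, one
sample point at a time. -/
theorem map_fst_withDensity_law (P : ClassifModel d)
    {f : EuclideanSpace ℝ (Fin d) × Bool → ENNReal} (hf : Measurable f) :
    (P.law.withDensity f).map Prod.fst = P.marginal.withDensity fun x =>
      ENNReal.ofReal (P.η x) * f (x, true) + ENNReal.ofReal (1 - P.η x) * f (x, false) := by
  ext s hs
  have hs' : MeasurableSet ((Prod.fst : EuclideanSpace ℝ (Fin d) × Bool → _) ⁻¹' s) :=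
    measurable_fst hs
  rw [Measure.map_apply measurable_fst hs, withDensity_apply _ hs', withDensity_apply _ hs,
    ← lintegral_indicator hs', ← lintegral_indicator hs, lintegral_law P (hf.indicator hs')]
  refine lintegral_congr fun x => ?_
  by_cases hx : x ∈ s <;> simp [indicator, hx]

/-- Integrating out the labels in a product over some sample points. -/
theorem setLIntegral_prod_le (P : ClassifModel d) {n : ℕ} (A : Finset (Fin n))
    {D : Set (Fin n → EuclideanSpace ℝ (Fin d))} (hD : MeasurableSet D)
    {g : EuclideanSpace ℝ (Fin d) × Bool → ENNReal} (hg : Measurable g) {ρ : ENNReal}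
    (hρ : ρ ≠ ⊤)
    (h : ∀ x, ENNReal.ofReal (P.η x) * g (x, true) +
      ENNReal.ofReal (1 - P.η x) * g (x, false) ≤ ρ) :
    ∫⁻ S in {S : Fin n → EuclideanSpace ℝ (Fin d) × Bool | (fun i => (S i).1) ∈ D},
      ∏ i ∈ A, g (S i) ∂(Measure.pi fun _ => P.law) ≤
    ρ ^ A.card * (Measure.pi fun _ => P.marginal) D := by
  classical
  have hη := P.measurable_η
  have h1 : ∀ x, ENNReal.ofReal (P.η x) * 1 + ENNReal.ofReal (1 - P.η x) * 1 = 1 := by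
    intro x
    have := P.η_mem x
    rw [mul_one, mul_one, ← ENNReal.ofReal_add this.1 (by linarith [this.2])]
    simp
  set f : Fin n → EuclideanSpace ℝ (Fin d) × Bool → ENNReal :=
    fun i => if i ∈ A then g else 1 with hf
  have hfm : ∀ i, Measurable (f i) := fun i => by
    by_cases hi : i ∈ A
    · simpa [hf, hi] using hg
    · simpa [hf, hi] using measurable_one
  set φ : Fin n → EuclideanSpace ℝ (Fin d) → ENNReal := fun i x =>
    ENNReal.ofReal (P.η x) * f i (x, true) + ENNReal.ofReal (1 - P.η x) * f i (x, false) with hφ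
  have hφm : ∀ i, Measurable (φ i) := fun i => by
    have := hfm i
    fun_prop
  have hφle : ∀ i x, φ i x ≤ if i ∈ A then ρ else 1 := fun i x => by
    by_cases hi : i ∈ A
    · simpa [hφ, hf, hi] using h x
    · simpa [hφ, hf, hi] using (h1 x).le
  have hfin : ∀ i, IsFiniteMeasure (P.law.withDensity (f i)) := fun i => by
    refine isFiniteMeasure_withDensity ?_
    rw [lintegral_law P (hfm i)]
    refine ((lintegral_mono (hφle i)).trans_lt ?_).ne
    rw [lintegral_const, measure_univ, mul_one]
    split_ifs
    · exact hρ.lt_top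
    · exact ENNReal.one_lt_top
  have hmap : ∀ i, (P.law.withDensity (f i)).map Prod.fst = P.marginal.withDensity (φ i) :=
    fun i => map_fst_withDensity_law P (hfm i)
  have hfin' : ∀ i, IsFiniteMeasure (P.marginal.withDensity (φ i)) := fun i => by
    rw [← hmap i]
    infer_instance
  -- The labels are integrated out coordinatewise before restricting to D, so D may couple all
  -- inputs, as the choice of the nearest neighbors does.
  have key : ((Measure.pi fun _ : Fin n => P.law).withDensity fun S => ∏ i, f i (S i)).map
      (fun S i => (S i).1) =
      (Measure.pi fun _ : Fin n => P.marginal).withDensity fun x => ∏ i, φ i (x i) := by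
    rw [← pi_withDensity (fun _ => P.law) f hfm, ← pi_withDensity (fun _ => P.marginal) φ hφm]
    simp_rw [← hmap]
    have : ∀ i, SigmaFinite ((P.law.withDensity (f i)).map Prod.fst) := fun i => inferInstance
    exact Measure.pi_map_pi (f := fun _ => Prod.fst) fun i => measurable_fst.aemeasurable
  have hfst : Measurable fun (S : Fin n → EuclideanSpace ℝ (Fin d) × Bool) i => (S i).1 := by
    fun_prop
  have key2 := congrArg (fun m : Measure _ => m D) key
  simp only [Measure.map_apply hfst hD] at key2
  rw [withDensity_apply _ (hfst hD), withDensity_apply _ hD] at key2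
  have hprod : ∀ S : Fin n → EuclideanSpace ℝ (Fin d) × Bool,
      ∏ i, f i (S i) = ∏ i ∈ A, g (S i) := by
    intro S
    rw [← Finset.prod_subset (Finset.subset_univ A)]
    · exact Finset.prod_congr rfl fun i hi => by simp [hf, hi]
    · intro i _ hi
      simp [hf, hi]
  simp_rw [hprod] at key2
  refine key2.trans_le ?_
  calc ∫⁻ x in D, ∏ i, φ i (x i) ∂(Measure.pi fun _ => P.marginal)
      ≤ ∫⁻ _x in D, ρ ^ A.card ∂(Measure.pi fun _ => P.marginal) := by
        refine lintegral_mono fun x => ?_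
        refine (Finset.prod_le_prod' fun i _ => hφle i (x i)).trans_eq ?_
        rw [Finset.prod_ite_mem, Finset.univ_inter, Finset.prod_const]
    _ = _ := by rw [setLIntegral_const]

/-- The conditional probability of the label `b` at `x`. -/
noncomputable def labelProb (P : ClassifModel d) (b : Bool) (x : EuclideanSpace ℝ (Fin d)) : ℝ :=
  if b = true then P.η x else 1 - P.η x

/-- The weight is the optimal Chernoff tilt for a Bernoulli variable of parameter (1 + Δ)/2. There
the mean is √(1 - Δ²), and a larger q only lowers it, since the weight is at most its inverse. -/
theorem tilted_mean_le_exp {Δ q : ℝ} (hΔ : 0 < Δ) (hΔ1 : Δ < 1) (hq : Δ ≤ 2 * q - 1) :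
    q * √((1 - Δ) / (1 + Δ)) + (1 - q) * (√((1 - Δ) / (1 + Δ)))⁻¹ ≤ Real.exp (-(Δ ^ 2 / 2)) := by
  have h1 : 0 < 1 - Δ := by linarith
  have h2 : 0 < 1 + Δ := by linarith
  have hs1 := Real.sqrt_pos.2 h1
  have hs2 := Real.sqrt_pos.2 h2
  have hq1 := Real.sq_sqrt h1.le
  have hq2 := Real.sq_sqrt h2.le
  have hle : √((1 - Δ) / (1 + Δ)) ≤ 1 :=
    Real.sqrt_le_one.2 ((div_le_one h2).2 (by linarith))
  have hpos : 0 < √((1 - Δ) / (1 + Δ)) := Real.sqrt_pos.2 (div_pos h1 h2)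
  have hinv : 1 ≤ (√((1 - Δ) / (1 + Δ)))⁻¹ := (one_le_inv₀ hpos).2 hle
  have hmono : q * √((1 - Δ) / (1 + Δ)) + (1 - q) * (√((1 - Δ) / (1 + Δ)))⁻¹ ≤
      (1 + Δ) / 2 * √((1 - Δ) / (1 + Δ)) + (1 - Δ) / 2 * (√((1 - Δ) / (1 + Δ)))⁻¹ := by
    nlinarith
  refine hmono.trans ?_
  have heq : (1 + Δ) / 2 * √((1 - Δ) / (1 + Δ)) + (1 - Δ) / 2 * (√((1 - Δ) / (1 + Δ)))⁻¹ =
      √(1 - Δ) * √(1 + Δ) := by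
    rw [Real.sqrt_div h1.le]
    field_simp
    nlinarith
  rw [heq]
  refine abs_le_of_sq_le_sq' ?_ (Real.exp_pos _).le |>.2
  rw [mul_pow, hq1, hq2, ← Real.exp_nat_mul]
  have := Real.add_one_le_exp (-Δ ^ 2)
  have he : ((2 : ℕ) : ℝ) * -(Δ ^ 2 / 2) = -Δ ^ 2 := by push_cast; ring
  rw [he]
  nlinarith

theorem marginal_compl_Ω (P : ClassifModel d) : P.marginal P.Ωᶜ = 0 := by
  rw [marginal, Ω, withDensity_apply _ P.isOpen_support.measurableSet.compl]
  refine (setLIntegral_congr_fun P.isOpen_support.measurableSet.compl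
    (g := fun _ => 0) fun x hx => ?_).trans (by simp)
  simp only [mem_compl_iff, Function.mem_support, not_not] at hx
  simp [hx]

theorem ae_mem_Ω (P : ClassifModel d) : ∀ᵐ x ∂P.marginal, x ∈ P.Ω :=
  P.marginal_compl_Ω

theorem measurePreserving_fst_law (P : ClassifModel d) :
    MeasurePreserving Prod.fst P.law P.marginal := ⟨measurable_fst, P.map_fst_law⟩

/-- The nearest neighbor rule rarely disagrees with the Bayes rule at a point around which the
Bayes label is more likely by a margin `Δ`. -/
theorem disagree_knnClassifier_le (P : ClassifModel d) {n k : ℕ} (hk : 1 ≤ k) (hkn : k ≤ n)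
    (x : EuclideanSpace ℝ (Fin d)) {δ Δ : ℝ} (hΔ : 0 < Δ) (hΔ1 : Δ < 1)
    (hG : ∀ y ∈ P.Ω, ‖y - x‖ < δ → Δ ≤ 2 * P.labelProb (P.bayes x) y - 1) :
    P.disagree (knnClassifier n k) x ≤
      Real.exp (k - n * P.marginal.real (Metric.ball x δ) / 2) + Real.exp (-(k * Δ ^ 2 / 2)) := by
  classical
  set b := P.bayes x with hb
  set ν := Measure.pi fun _ : Fin n => P.law with hν
  set r : ℝ := √((1 - Δ) / (1 + Δ)) with hr
  have hr0 : 0 < r := Real.sqrt_pos.2 (div_pos (by linarith) (by linarith))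
  have hr1 : r ≤ 1 := Real.sqrt_le_one.2 ((div_le_one (by linarith)).2 (by linarith))
  set G : Set (EuclideanSpace ℝ (Fin d)) := P.Ω ∩ Metric.ball x δ with hGdef
  have hGm : MeasurableSet G := P.isOpen_support.measurableSet.inter measurableSet_ball
  -- A label equal to b costs r, another one r⁻¹. The value 0 outside G makes the mean bound hold at
  -- every y, and nothing is lost when all k neighbors lie in G.
  set g : EuclideanSpace ℝ (Fin d) × Bool → ENNReal := fun z =>
    if z.1 ∈ G then ENNReal.ofReal (if z.2 = b then r else r⁻¹) else 0 with hg
  have hgm : Measurable g := by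
    refine Measurable.ite (measurable_fst hGm) (Measurable.ennreal_ofReal ?_) measurable_const
    exact Measurable.ite (measurable_snd (measurableSet_singleton b)) measurable_const
      measurable_const
  set ρ : ENNReal := ENNReal.ofReal (Real.exp (-(Δ ^ 2 / 2))) with hρ
  have hgρ : ∀ y, ENNReal.ofReal (P.η y) * g (y, true) +
      ENNReal.ofReal (1 - P.η y) * g (y, false) ≤ ρ := by
    intro y
    by_cases hy : y ∈ G
    · have h1 := P.η_mem y
      have h2 := hG y hy.1 (mem_ball_iff_norm.1 hy.2)
      have h3 := tilted_mean_le_exp hΔ hΔ1 h2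
      rw [← hr] at h3
      simp only [hg, hy, if_true]
      rw [← ENNReal.ofReal_mul h1.1, ← ENNReal.ofReal_mul (by linarith [h1.2]),
        ← ENNReal.ofReal_add (mul_nonneg h1.1 (by split_ifs <;> positivity))
          (mul_nonneg (by linarith [h1.2]) (by split_ifs <;> positivity))]
      refine ENNReal.ofReal_le_ofReal (le_trans (le_of_eq ?_) h3)
      rcases Bool.eq_false_or_eq_true b with h | h
      · simp [labelProb, h]
      · simp [labelProb, h, add_comm]
    · simp [hg, hy]
  set D : Finset (Fin n) → Set (Fin n → EuclideanSpace ℝ (Fin d)) :=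
    fun A => {X | nearestIndices k X x = A} with hD
  have hDm : ∀ A, MeasurableSet (D A) := fun A =>
    measurableSet_nearestIndices_eq k (fun i => measurable_pi_apply i) measurable_const A
  have hfst : Measurable fun (S : Fin n → EuclideanSpace ℝ (Fin d) × Bool) i => (S i).1 := by
    fun_prop
  -- The neighbor set A is random but depends on the inputs alone: Markov's inequality is applied
  -- for each fixed A, and the events D A are disjoint, so no factor counting the sets A appears.
  set E : Finset (Fin n) → Set (Fin n → EuclideanSpace ℝ (Fin d) × Bool) := fun A =>
    {S | 1 ≤ ∏ i ∈ A, g (S i)} ∩ {S | (fun i => (S i).1) ∈ D A} with hE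
  have hEle : ∀ A, ν (E A) ≤ ρ ^ k * (Measure.pi fun _ => P.marginal) (D A) := by
    intro A
    by_cases hA : A.card = k
    · have h1 := setLIntegral_prod_le P A (hDm A) hgm ENNReal.ofReal_ne_top hgρ
      rw [hA] at h1
      refine le_trans ?_ h1
      have hpm : Measurable fun S : Fin n → EuclideanSpace ℝ (Fin d) × Bool =>
          ∏ i ∈ A, g (S i) :=
        Finset.measurable_prod _ fun i _ => hgm.comp (measurable_pi_apply i)
      have h2 := mul_meas_ge_le_lintegral (μ := ν.restrict
        {S : Fin n → EuclideanSpace ℝ (Fin d) × Bool | (fun i => (S i).1) ∈ D A}) hpm 1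
      rwa [one_mul, Measure.restrict_apply (measurableSet_le measurable_const hpm)] at h2
    · have : E A = ∅ := by
        refine eq_empty_of_forall_notMem fun S hS => hA ?_
        rw [← show nearestIndices k (fun i => (S i).1) x = A from hS.2, card_nearestIndices hkn]
      rw [this, measure_empty]
      exact zero_le
  set F : Set (Fin n → EuclideanSpace ℝ (Fin d) × Bool) :=
    {S | (Finset.univ.filter fun i => S i ∈ Prod.fst ⁻¹' Metric.ball x δ).card < k} with hF
  set N : Set (Fin n → EuclideanSpace ℝ (Fin d) × Bool) := {S | ¬ ∀ i, (S i).1 ∈ P.Ω} with hN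
  have hN0 : ν N = 0 := by
    have : ∀ᵐ S ∂ν, ∀ i, (S i).1 ∈ P.Ω := by
      refine ae_all_iff.2 fun i => ?_
      exact (P.measurePreserving_fst_law.comp
        (measurePreserving_eval (fun _ : Fin n => P.law) i)).quasiMeasurePreserving.ae P.ae_mem_Ω
    exact this
  have hsub : {S | knnClassifier n k S x ≠ b} ⊆ F ∪ N ∪ ⋃ A, E A := by
    intro S hS
    by_cases hSF : S ∈ F
    · exact Or.inl (Or.inl hSF)
    by_cases hSN : S ∈ N
    · exact Or.inl (Or.inr hSN)
    refine Or.inr (mem_iUnion.2 ⟨nearestIndices k (fun i => (S i).1) x, ?_, rfl⟩)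
    set A := nearestIndices k (fun i => (S i).1) x with hA
    have hAc : A.card = k := card_nearestIndices hkn _ _
    have hAG : ∀ i ∈ A, (S i).1 ∈ G := by
      intro i hi
      refine ⟨by_contra fun h => hSN fun h' => h (h' i), mem_ball_iff_norm.2 ?_⟩
      refine norm_lt_of_mem_nearestIndices (X := fun i => (S i).1) ?_ hi
      refine (not_lt.1 hSF).trans_eq ?_
      congr 1
    have hprod : ∏ i ∈ A, g (S i) =
        ENNReal.ofReal (∏ i ∈ A, if (S i).2 = b then r else r⁻¹) := by
      rw [ENNReal.ofReal_prod_of_nonneg fun i _ => by split_ifs <;> positivity]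
      exact Finset.prod_congr rfl fun i hi => by simp only [hg, hAG i hi, if_true]
    change 1 ≤ ∏ i ∈ A, g (S i)
    rw [hprod, ← ENNReal.ofReal_one]
    refine ENNReal.ofReal_le_ofReal ?_
    rw [Finset.prod_ite, Finset.prod_const, Finset.prod_const]
    set c := (A.filter fun i => (S i).2 = b).card with hc
    set c' := (A.filter fun i => ¬ (S i).2 = b).card with hc'
    have hcc : c + c' = k := by
      rw [← hAc]
      exact Finset.card_filter_add_card_filter_not _
    have hcle : c ≤ c' := by
      have hS' : knnClassifier n k S x ≠ b := hS
      rw [knnClassifier_eq, ← hA, Finset.sum_boole] at hS'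
      have hk0 : (0 : ℝ) < k := by exact_mod_cast hk
      simp only [one_div_mul_eq_div, lt_div_iff₀ hk0] at hS'
      have hkk : (k : ℝ) = c + c' := by exact_mod_cast hcc.symm
      -- The rule answers 0 on a tie, so an error means c ≤ k/2 if b is true and c' > k/2 if b is
      -- false; c ≤ c' covers both.
      rcases Bool.eq_false_or_eq_true b with h | h
      · simp only [h, ne_eq, decide_eq_true_eq, not_lt] at hS'
        have hcR : (c : ℝ) ≤ k / 2 := by
          rw [hc, h]
          exact hS'
        have : (c : ℝ) ≤ c' := by linarith
        exact_mod_cast this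
      · simp only [h, ne_eq, decide_eq_false_iff_not, not_not] at hS'
        have hcR : (k : ℝ) / 2 < c' := by
          rw [hc', h]
          simpa using hS'
        have : (c : ℝ) ≤ c' := by linarith
        exact_mod_cast this
    obtain ⟨m, hm⟩ := Nat.exists_eq_add_of_le hcle
    rw [hm, pow_add, ← mul_assoc, ← mul_pow, mul_inv_cancel₀ hr0.ne', one_pow, one_mul]
    exact one_le_pow₀ ((one_le_inv₀ hr0).2 hr1)
  have hsum : ν (⋃ A, E A) ≤ ρ ^ k := by
    calc ν (⋃ A, E A) ≤ ∑ A, ν (E A) := measure_iUnion_fintype_le _ _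
      _ ≤ ∑ A, ρ ^ k * (Measure.pi fun _ => P.marginal) (D A) :=
        Finset.sum_le_sum fun A _ => hEle A
      _ = ρ ^ k * ∑ A, (Measure.pi fun _ => P.marginal) (D A) := by rw [Finset.mul_sum]
      _ ≤ ρ ^ k * 1 := by
        gcongr
        rw [← measure_univ (μ := Measure.pi fun _ : Fin n => P.marginal)]
        refine sum_measure_le_measure_univ (fun A _ => (hDm A).nullMeasurableSet) ?_
        intro A _ A' _ hAA
        refine Disjoint.aedisjoint (disjoint_left.2 fun X hX hX' => hAA ?_)
        exact hX.symm.trans hX'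
      _ = ρ ^ k := mul_one _
  have hFle := measureReal_card_lt_le P.law
    (B := Prod.fst ⁻¹' Metric.ball x δ) (measurable_fst measurableSet_ball) n k
  rw [P.measurePreserving_fst_law.measureReal_preimage
    measurableSet_ball.nullMeasurableSet] at hFle
  have hρk : (ρ ^ k).toReal = Real.exp (-(k * Δ ^ 2 / 2)) := by
    rw [hρ, ENNReal.toReal_pow, ENNReal.toReal_ofReal (Real.exp_pos _).le, ← Real.exp_nat_mul]
    ring_nf
  calc P.disagree (knnClassifier n k) x = ν.real {S | knnClassifier n k S x ≠ b} := rfl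
    _ ≤ ν.real (F ∪ N ∪ ⋃ A, E A) := measureReal_mono hsub (measure_ne_top _ _)
    _ ≤ ν.real F + ν.real N + ν.real (⋃ A, E A) :=
      (measureReal_union_le _ _).trans (by gcongr; exact measureReal_union_le _ _)
    _ ≤ _ := by
      have h1 : ν.real N = 0 := by rw [measureReal_def, hN0, ENNReal.toReal_zero]
      have h2 : ν.real (⋃ A, E A) ≤ Real.exp (-(k * Δ ^ 2 / 2)) := by
        rw [← hρk]
        exact ENNReal.toReal_mono (ENNReal.pow_ne_top ENNReal.ofReal_ne_top) hsum
      rw [h1, add_zero]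
      exact add_le_add hFle h2

end ClassifModel

/-! ### The generalized inverse of ψ. -/

section TailInv

variable {ψ : ℝ → ℝ} {r : ℝ}

theorem tailInv_nonneg (ψ : ℝ → ℝ) (r y : ℝ) : 0 ≤ tailInv ψ r y :=
  Real.sInf_nonneg fun _ ht => ht.1.le

theorem bddBelow_tailInv (ψ : ℝ → ℝ) (r y : ℝ) : BddBelow {t : ℝ | 0 < t ∧ t < r ∧ y ≤ ψ t} :=
  ⟨0, fun _ ht => ht.1.le⟩

theorem tailInv_le {s y : ℝ} (h0 : 0 < s) (h1 : s < r) (h : y ≤ ψ s) : tailInv ψ r y ≤ s :=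
  csInf_le (bddBelow_tailInv ψ r y) ⟨h0, h1, h⟩

theorem lt_of_lt_tailInv {s y : ℝ} (h0 : 0 < s) (h1 : s < r) (h : s < tailInv ψ r y) :
    ψ s < y := by
  by_contra hc
  exact (tailInv_le h0 h1 (not_lt.1 hc)).not_gt h

/-- The infimum of the empty set is 0 by convention, so a positive value certifies that the level y
is reached on (0, r). -/
theorem nonempty_of_tailInv_pos {y : ℝ} (h : 0 < tailInv ψ r y) :
    {t : ℝ | 0 < t ∧ t < r ∧ y ≤ ψ t}.Nonempty := by
  by_contra hc
  rw [tailInv, not_nonempty_iff_eq_empty.1 hc, Real.sInf_empty] at h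
  exact h.false

theorem tailInv_mono {y y' : ℝ} (hy : y ≤ y') (h : 0 < tailInv ψ r y') :
    tailInv ψ r y ≤ tailInv ψ r y' :=
  csInf_le_csInf (bddBelow_tailInv ψ r y) (nonempty_of_tailInv_pos h)
    fun _ ht => ⟨ht.1, ht.2.1, hy.trans ht.2.2⟩

/-- The infimum need not be attained when ψ jumps, hence the strict inequality below e; a point of
the defining set lies in between. -/
theorem le_of_tailInv_lt (hψ : StrictMonoOn ψ (Ioo 0 r)) {e y : ℝ} (h : 0 < tailInv ψ r y)
    (h1 : tailInv ψ r y < e) (h2 : e < r) : y ≤ ψ e := by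
  obtain ⟨s, hs, hse⟩ := exists_lt_of_csInf_lt (nonempty_of_tailInv_pos h) h1
  exact hs.2.2.trans (hψ ⟨hs.1, hs.2.1⟩ ⟨hs.1.trans hse, h2⟩ hse).le

theorem pos_of_tendsto_zero (hψ : StrictMonoOn ψ (Ioo 0 r)) (h0 : Tendsto ψ (𝓝[>] 0) (𝓝 0))
    {s : ℝ} (hs : s ∈ Ioo 0 r) : 0 < ψ s := by
  have hs2 : s / 2 ∈ Ioo 0 r := ⟨by linarith [hs.1], by linarith [hs.1, hs.2]⟩
  have h1 : 0 ≤ ψ (s / 2) := by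
    refine le_of_tendsto h0 ?_
    filter_upwards [Ioo_mem_nhdsGT hs2.1] with u hu
    exact (hψ ⟨hu.1, hu.2.trans hs2.2⟩ hs2 hu.2).le
  exact h1.trans_lt (hψ hs2 hs (by linarith [hs.1]))

/-- As ψ tends to 0 at 0, it stays below y on some (0, u), which bounds the defining set away from
0. -/
theorem tailInv_pos (h0 : Tendsto ψ (𝓝[>] 0) (𝓝 0)) {y s : ℝ} (hy : 0 < y) (hs : 0 < s)
    (hsr : s < r) (hys : y ≤ ψ s) : 0 < tailInv ψ r y := by
  have h1 : ∀ᶠ t in 𝓝[>] 0, ψ t < y := h0.eventually (gt_mem_nhds hy)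
  obtain ⟨u, hu, hu'⟩ := mem_nhdsGT_iff_exists_Ioo_subset.1 h1
  refine lt_of_lt_of_le hu (le_csInf ⟨s, hs, hsr, hys⟩ fun t ht => ?_)
  by_contra hc
  exact (hu' ⟨ht.1, not_le.1 hc⟩ : ψ t < y).not_ge ht.2.2

end TailInv

/-! ### Integrating the pointwise error with the margin condition. -/

theorem summable_rpow_mul_exp (β : ℝ) :
    Summable fun j : ℕ => ((j : ℝ) + 1) ^ β * Real.exp (-((j : ℝ) ^ 2 / 4)) := by
  have h := (summable_nat_add_iff 1).2 (Real.summable_pow_mul_exp_neg_nat_mul ⌈β⌉₊ one_pos)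
  refine Summable.of_nonneg_of_le (fun j => by positivity) (fun j => ?_)
    (h.mul_left (Real.exp 2))
  have h1 : (1 : ℝ) ≤ (j : ℝ) + 1 := by linarith [(Nat.cast_nonneg j : (0 : ℝ) ≤ j)]
  have h2 : ((j : ℝ) + 1) ^ β ≤ ((j : ℝ) + 1) ^ ⌈β⌉₊ := by
    rw [← Real.rpow_natCast]
    exact Real.rpow_le_rpow_of_exponent_le h1 (Nat.le_ceil β)
  -- From (j/2 - 1)² ≥ 0 one gets -j²/4 ≤ 2 - (j + 1), which explains the factor e².
  have h3 : Real.exp (-((j : ℝ) ^ 2 / 4)) ≤ Real.exp 2 * Real.exp (-1 * ((j : ℝ) + 1)) := by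
    rw [← Real.exp_add]
    refine Real.exp_le_exp.2 ?_
    nlinarith [sq_nonneg ((j : ℝ) / 2 - 1)]
  calc _ ≤ ((j : ℝ) + 1) ^ ⌈β⌉₊ * (Real.exp 2 * Real.exp (-1 * ((j : ℝ) + 1))) := by gcongr
    _ = _ := by push_cast; ring

/-- The constant in the integrated form of the margin condition. -/
noncomputable def marginSum (α : ℝ) : ℝ :=
  ∑' j : ℕ, ((j : ℝ) + 1) ^ (1 + α) * Real.exp (-((j : ℝ) ^ 2 / 4))

theorem marginSum_nonneg (α : ℝ) : 0 ≤ marginSum α := tsum_nonneg fun j => by positivity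

namespace ClassifModel

variable {d : ℕ}

theorem abs_eta_le (P : ClassifModel d) (x : EuclideanSpace ℝ (Fin d)) :
    |P.η x - 1 / 2| ≤ 1 / 2 := by
  have := P.η_mem x
  rw [abs_le]
  constructor <;> linarith [this.1, this.2]

theorem measurable_abs_eta (P : ClassifModel d) : Measurable fun x => |P.η x - 1 / 2| := by
  have := P.measurable_η
  fun_prop

/-- A point with jν ≤ Δ < (j+1)ν contributes at most 2(j+1)ν exp(-j²/4). It is charged to the whole
set {0 < Δ < (j+1)ν}, whose mass the margin condition controls directly; the Gaussian factor makes
the sum over j converge. Only finitely many layers occur, as Δ is bounded. -/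
theorem integral_margin_le (P : ClassifModel d) {α M ν : ℝ} (hν : 0 < ν)
    (hM : 0 ≤ M) (h : ∀ t : ℝ, 0 < t →
      P.marginal.real {x | 0 < |P.η x - 1 / 2| ∧ |P.η x - 1 / 2| < t} ≤ M * t ^ α) :
    ∫ x, 2 * |P.η x - 1 / 2| * Real.exp (-(|P.η x - 1 / 2| ^ 2 / (4 * ν ^ 2))) ∂P.marginal ≤
      2 * M * marginSum α * ν ^ (1 + α) := by
  have hηm := P.measurable_abs_eta
  set J := ⌊1 / ν⌋₊ + 1 with hJ
  set T : ℕ → Set (EuclideanSpace ℝ (Fin d)) := fun j =>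
    {x | 0 < |P.η x - 1 / 2| ∧ |P.η x - 1 / 2| < (j + 1) * ν} with hT
  have hTm : ∀ j, MeasurableSet (T j) := fun j =>
    (measurableSet_lt measurable_const hηm).inter (measurableSet_lt hηm measurable_const)
  set c : ℕ → ℝ := fun j => 2 * ((j + 1) * ν) * Real.exp (-((j : ℝ) ^ 2 / 4)) with hc
  have hc0 : ∀ j, 0 ≤ c j := fun j => by positivity
  have hpt : ∀ x, 2 * |P.η x - 1 / 2| * Real.exp (-(|P.η x - 1 / 2| ^ 2 / (4 * ν ^ 2))) ≤
      ∑ j ∈ Finset.range J, (T j).indicator (fun _ => c j) x := by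
    intro x
    set Δ := |P.η x - 1 / 2| with hΔ
    have hnn : ∀ j ∈ Finset.range J, 0 ≤ (T j).indicator (fun _ => c j) x :=
      fun j _ => indicator_nonneg (fun _ _ => hc0 j) x
    rcases (abs_nonneg (P.η x - 1 / 2)).eq_or_lt with h0 | h0
    · rw [hΔ, ← h0]
      simpa using Finset.sum_nonneg hnn
    have hfl := Nat.floor_le (div_nonneg h0.le hν.le)
    have hfl' := Nat.lt_floor_add_one (Δ / ν)
    set j := ⌊Δ / ν⌋₊ with hj
    have hjJ : j ∈ Finset.range J := by
      rw [Finset.mem_range, hJ, Nat.lt_succ_iff]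
      refine Nat.floor_le_floor ?_
      have := P.abs_eta_le x
      gcongr
      linarith
    refine le_trans ?_ (Finset.single_le_sum hnn hjJ)
    have hxT : x ∈ T j := ⟨h0, (div_lt_iff₀ hν).1 hfl'⟩
    rw [indicator_of_mem hxT]
    have hjΔ : (j : ℝ) ^ 2 / 4 ≤ Δ ^ 2 / (4 * ν ^ 2) := by
      have : (j : ℝ) ^ 2 ≤ (Δ / ν) ^ 2 := pow_le_pow_left₀ (Nat.cast_nonneg _) hfl 2
      rw [div_pow] at this
      calc (j : ℝ) ^ 2 / 4 ≤ Δ ^ 2 / ν ^ 2 / 4 := by gcongr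
        _ = _ := by rw [div_div, mul_comm]
    have := hxT.2
    simp only [hc]
    gcongr
  have hint : ∀ j ∈ Finset.range J, Integrable ((T j).indicator (fun _ => c j)) P.marginal :=
    fun j _ => (integrable_const _).indicator (hTm j)
  calc _ ≤ ∫ x, ∑ j ∈ Finset.range J, (T j).indicator (fun _ => c j) x ∂P.marginal := by
        refine integral_mono_of_nonneg (ae_of_all _ fun x => by positivity)
          (integrable_finsetSum _ hint) (ae_of_all _ hpt)
    _ = ∑ j ∈ Finset.range J, P.marginal.real (T j) * c j := by
        rw [integral_finsetSum _ hint]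
        refine Finset.sum_congr rfl fun j _ => ?_
        rw [integral_indicator_const _ (hTm j), smul_eq_mul]
    _ ≤ ∑ j ∈ Finset.range J, 2 * M * ν ^ (1 + α) *
          (((j : ℝ) + 1) ^ (1 + α) * Real.exp (-((j : ℝ) ^ 2 / 4))) := by
        refine Finset.sum_le_sum fun j _ => ?_
        have hj1 : 0 < (j : ℝ) + 1 := by positivity
        refine (mul_le_mul_of_nonneg_right (h _ (by positivity)) (hc0 j)).trans_eq ?_
        rw [Real.mul_rpow hj1.le hν.le, Real.rpow_add hν, Real.rpow_add hj1, Real.rpow_one,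
          Real.rpow_one]
        ring
    _ ≤ _ := by
        rw [← Finset.mul_sum]
        have := (summable_rpow_mul_exp (1 + α)).sum_le_tsum (Finset.range J)
          fun j _ => by positivity
        calc _ ≤ 2 * M * ν ^ (1 + α) * marginSum α :=
              mul_le_mul_of_nonneg_left this (by positivity)
          _ = _ := by ring

theorem excessRisk_le_one (P : ClassifModel d) {n : ℕ}
    (Φ : (Fin n → EuclideanSpace ℝ (Fin d) × Bool) → EuclideanSpace ℝ (Fin d) → Bool) :
    P.excessRisk Φ ≤ 1 := by
  have h1 : P.sampleRisk Φ ≤ 1 := measureReal_le_one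
  have h2 : 0 ≤ P.risk P.bayes := measureReal_nonneg
  rw [excessRisk]
  linarith

/-- From a pointwise bound outside of a low density region to the excess risk. -/
theorem excessRisk_le (P : ClassifModel d) {n : ℕ}
    {Φ : (Fin n → EuclideanSpace ℝ (Fin d) × Bool) → EuclideanSpace ℝ (Fin d) → Bool}
    (hΦ : Measurable (Function.uncurry Φ)) {α M ν e w A : ℝ} {s : ℝ} (hν : 0 < ν)
    (hM : 0 ≤ M) (hA : 0 ≤ A) (hw : 0 ≤ w) (h : ∀ t : ℝ, 0 < t →
      P.marginal.real {x | 0 < |P.η x - 1 / 2| ∧ |P.η x - 1 / 2| < t} ≤ M * t ^ α)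
    (hs : P.marginal.real {x | P.μ x < e} ≤ s)
    (hp : ∀ x ∈ P.Ω, e ≤ P.μ x → 0 < |P.η x - 1 / 2| → P.disagree Φ x ≤
      w + A * Real.exp (-(|P.η x - 1 / 2| ^ 2 / (4 * ν ^ 2)))) :
    P.excessRisk Φ ≤ s + w + A * (2 * M * marginSum α * ν ^ (1 + α)) := by
  have hηm := P.measurable_abs_eta
  have hTm : MeasurableSet {x | P.μ x < e} := measurableSet_lt P.measurable_μ measurable_const
  set f : EuclideanSpace ℝ (Fin d) → ℝ := fun x =>
    2 * |P.η x - 1 / 2| * Real.exp (-(|P.η x - 1 / 2| ^ 2 / (4 * ν ^ 2))) with hf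
  have hf0 : ∀ x, 0 ≤ f x := fun x => by positivity
  have hfi : Integrable f P.marginal := by
    refine Integrable.of_bound (C := 1) (Measurable.aestronglyMeasurable (by fun_prop))
      (ae_of_all _ fun x => ?_)
    rw [Real.norm_eq_abs, abs_of_nonneg (hf0 x)]
    have h1 := P.abs_eta_le x
    have h2 : Real.exp (-(|P.η x - 1 / 2| ^ 2 / (4 * ν ^ 2))) ≤ 1 :=
      Real.exp_le_one_iff.2 (neg_nonpos.2 (by positivity))
    have h3 := Real.exp_pos (-(|P.η x - 1 / 2| ^ 2 / (4 * ν ^ 2)))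
    simp only [hf]
    nlinarith [abs_nonneg (P.η x - 1 / 2)]
  have hi1 : Integrable ({x | P.μ x < e}.indicator fun _ => (1 : ℝ)) P.marginal :=
    (integrable_const _).indicator hTm
  rw [excessRisk_eq P hΦ]
  calc _ ≤ ∫ x, (({x | P.μ x < e}.indicator (fun _ => (1 : ℝ)) x + w) + A * f x) ∂P.marginal := by
        refine integral_mono_of_nonneg (ae_of_all _ fun x =>
          mul_nonneg (abs_nonneg _) (disagree_nonneg _ _ _))
          ((hi1.add (integrable_const _)).add (hfi.const_mul _)) ?_
        filter_upwards [P.ae_mem_Ω] with x hx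
        have h1 := P.abs_eta_le x
        have h2 : |2 * P.η x - 1| = 2 * |P.η x - 1 / 2| := by
          rw [show 2 * P.η x - 1 = 2 * (P.η x - 1 / 2) by ring, abs_mul, abs_two]
        have h3 := P.disagree_le_one Φ x
        have h4 := P.disagree_nonneg Φ x
        have h5 := mul_nonneg hA (hf0 x)
        have h6 := abs_nonneg (P.η x - 1 / 2)
        rw [h2]
        by_cases hxe : P.μ x < e
        · rw [indicator_of_mem (show x ∈ {x | P.μ x < e} from hxe)]
          nlinarith
        · rw [indicator_of_notMem (show x ∉ {x | P.μ x < e} from hxe)]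
          rcases h6.eq_or_lt with h0 | h0
          · rw [← h0]
            linarith
          · have h7 := mul_le_mul_of_nonneg_left (hp x hx (not_lt.1 hxe) h0)
              (mul_nonneg zero_le_two h6)
            have h8 : 2 * |P.η x - 1 / 2| * w ≤ w := by nlinarith
            have h9 : 2 * |P.η x - 1 / 2| *
                (A * Real.exp (-(|P.η x - 1 / 2| ^ 2 / (4 * ν ^ 2)))) = A * f x := by
              simp only [hf]; ring
            rw [mul_add, h9] at h7
            linarith
    _ = P.marginal.real {x | P.μ x < e} + w + A * ∫ x, f x ∂P.marginal := by
        have hi2 : Integrable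
            (fun x => {x | P.μ x < e}.indicator (fun _ => (1 : ℝ)) x + w) P.marginal :=
          hi1.add (integrable_const _)
        rw [integral_add hi2 (hfi.const_mul _),
          integral_add hi1 (integrable_const _), integral_const_mul, integral_indicator_const _ hTm]
        simp
    _ ≤ _ := by
        have := P.integral_margin_le hν hM h
        gcongr

end ClassifModel

/-! ### The upper bound for the nearest neighbor rule. -/

/-- One term of the exponential series, of degree ⌈β⌉ in ν⁻²/2, is enough. This absorbs the
probability of finding too few neighbors into the rate. -/
theorem exp_neg_inv_sq_le {ν β : ℝ} (hν : 0 < ν) (hν1 : ν ≤ 1) :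
    Real.exp (-(ν⁻¹ ^ 2 / 2)) ≤ (⌈β⌉₊.factorial * 2 ^ ⌈β⌉₊) * ν ^ β := by
  set m := ⌈β⌉₊
  have h := Real.pow_div_factorial_le_exp (ν⁻¹ ^ 2 / 2) (by positivity) m
  have h1 : ν ^ (2 * m) ≤ ν ^ β := by
    rw [← Real.rpow_natCast]
    refine Real.rpow_le_rpow_of_exponent_ge hν hν1 ?_
    push_cast
    linarith [Nat.le_ceil β, (Nat.cast_nonneg m : (0 : ℝ) ≤ m)]
  rw [Real.exp_neg]
  calc _ ≤ ((ν⁻¹ ^ 2 / 2) ^ m / m.factorial)⁻¹ := inv_anti₀ (by positivity) h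
    _ = (m.factorial * 2 ^ m) * ν ^ (2 * m) := by
      rw [div_pow, ← pow_mul, inv_pow]
      field_simp
    _ ≤ _ := by gcongr

/-- The pointwise error of the nearest neighbor rule for a model in the class. -/
theorem disagree_knn_le_of_mem {d : ℕ} (hd : 1 ≤ d) {L α M κ δ₀ : ℝ} (hL : 0 < L) (hκ : 0 < κ)
    {P : ClassifModel d} (hP : P ∈ smoothMarginClass d L α M)
    (hP' : P ∈ minimalMassClass d κ δ₀) {n : ℕ} {ν t a : ℝ} (hν : 0 < ν) (hν1 : ν ≤ 1)
    (ht : 0 < t) (hn : (n : ℝ)⁻¹ = ν ^ (2 + d) * t) (htν : ν ^ d * t ≤ 1)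
    (ha1 : 1 ≤ a) (haκ : 8 / κ ≤ a) (haδ : a * ν ≤ δ₀)
    {x : EuclideanSpace ℝ (Fin d)} (hx : x ∈ P.Ω) (hxt : t / 2 ≤ P.μ x)
    (hΔ : 0 < |P.η x - 1 / 2|) :
    P.disagree (knnClassifier n ⌊ν⁻¹ ^ 2⌋₊) x ≤ Real.exp (-(ν⁻¹ ^ 2 / 2)) +
      Real.exp ((L * a) ^ 2) * Real.exp (-(|P.η x - 1 / 2| ^ 2 / (4 * ν ^ 2))) := by
  set Δ := |P.η x - 1 / 2| with hΔdef
  set k := ⌊ν⁻¹ ^ 2⌋₊ with hk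
  have ha0 : 0 < a := by linarith
  have hinv1 : 1 ≤ ν⁻¹ ^ 2 := one_le_pow₀ ((one_le_inv₀ hν).2 hν1)
  have hk1 : 1 ≤ k := Nat.le_floor (by exact_mod_cast hinv1)
  have hkle : (k : ℝ) ≤ ν⁻¹ ^ 2 := Nat.floor_le (by positivity)
  have hkge : ν⁻¹ ^ 2 / 2 ≤ k := by
    have h1 := Nat.lt_floor_add_one (ν⁻¹ ^ 2)
    have h2 : (1 : ℝ) ≤ k := by exact_mod_cast hk1
    linarith
  have hn' : (n : ℝ) = ν⁻¹ ^ 2 * (ν ^ d * t)⁻¹ := by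
    rw [← inv_inv (n : ℝ), hn, pow_add, mul_assoc, mul_inv, inv_pow]
  have hnt : (n : ℝ) * (ν ^ d * t) = ν⁻¹ ^ 2 := by
    rw [hn', mul_assoc, inv_mul_cancel₀ (by positivity), mul_one]
  have hkn : k ≤ n := by
    have : (k : ℝ) ≤ n := by
      refine hkle.trans ?_
      rw [← hnt]
      exact mul_le_of_le_one_right (Nat.cast_nonneg _) htν
    exact_mod_cast this
  -- At a margin below the bias Laν of the neighborhood nothing is claimed: the factor exp((La)²)
  -- makes the right side at least 1.
  rcases lt_or_ge Δ (2 * (L * a * ν)) with hsmall | hbig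
  · have h1 : 1 ≤ Real.exp ((L * a) ^ 2) * Real.exp (-(Δ ^ 2 / (4 * ν ^ 2))) := by
      rw [← Real.exp_add]
      refine Real.one_le_exp ?_
      have : Δ ^ 2 / (4 * ν ^ 2) ≤ (L * a) ^ 2 := by
        rw [div_le_iff₀ (by positivity)]
        nlinarith
      linarith
    linarith [P.disagree_le_one (knnClassifier n k) x, Real.exp_pos (-(ν⁻¹ ^ 2 / 2))]
  · have hΔ1 : Δ < 1 := by linarith [P.abs_eta_le x]
    -- Within aν the regression function moves by at most Δ/2, so half of the margin at x survives
    -- at y.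
    have hG : ∀ y ∈ P.Ω, ‖y - x‖ < a * ν → Δ ≤ 2 * P.labelProb (P.bayes x) y - 1 := by
      intro y hy hyx
      have h1 := hP.1 y hy x hx
      have h2 : L * ‖y - x‖ ≤ L * (a * ν) := by gcongr
      have h3 : |P.η y - P.η x| ≤ Δ / 2 := by linarith
      rw [abs_le] at h3
      by_cases h : 1 / 2 < P.η x
      · rw [P.bayes_eq_true h, ClassifModel.labelProb, if_pos rfl]
        have : Δ = P.η x - 1 / 2 := abs_of_pos (by linarith)
        linarith
      · rw [P.bayes_eq_false (not_lt.1 h), ClassifModel.labelProb, if_neg Bool.false_ne_true]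
        have : Δ = -(P.η x - 1 / 2) := abs_of_nonpos (by linarith)
        linarith
    refine (P.disagree_knnClassifier_le hk1 hkn x hΔ hΔ1 hG).trans (add_le_add ?_ ?_)
    · refine Real.exp_le_exp.2 ?_
      have h1 := hP' (a * ν) (by positivity) haδ x hx
      have h2 : κ * (t / 2) * (a * ν) ^ d ≤ P.marginal.real (Metric.ball x (a * ν)) := by
        refine le_trans ?_ h1
        gcongr
      have h3 : a ≤ a ^ d := le_self_pow₀ ha1 (by omega)
      have h4 : 8 ≤ κ * a ^ d := by
        rw [div_le_iff₀ hκ] at haκ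
        nlinarith
      have h5 : (n : ℝ) * (κ * (t / 2) * (a * ν) ^ d) = κ * a ^ d / 2 * ν⁻¹ ^ 2 := by
        rw [← hnt, mul_pow]
        ring
      have h6 := mul_le_mul_of_nonneg_left h2 (Nat.cast_nonneg n : (0 : ℝ) ≤ n)
      rw [h5] at h6
      nlinarith
    · have h1 : 1 ≤ Real.exp ((L * a) ^ 2) := Real.one_le_exp (by positivity)
      refine le_trans ?_ (le_mul_of_one_le_left (Real.exp_pos _).le h1)
      refine Real.exp_le_exp.2 (neg_le_neg ?_)
      calc Δ ^ 2 / (4 * ν ^ 2) = ν⁻¹ ^ 2 / 2 * Δ ^ 2 / 2 := by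
            field_simp
            norm_num
        _ ≤ _ := by gcongr

theorem knn_upper_bound {d : ℕ} (hd : 1 ≤ d) {α L M r : ℝ} {ψ : ℝ → ℝ} (hα : 0 < α) (hL : 0 < L)
    (hM : 0 < M) (hr : 0 < r) (hψ : StrictMonoOn ψ (Ioo 0 r))
    (hψ0 : Tendsto ψ (𝓝[>] 0) (𝓝 0)) {κ δ₀ ε₀ : ℝ} (hκ : 0 < κ) (hδ₀ : 0 < δ₀) (hε₀ : 0 < ε₀) :
    ∃ C : ℝ, 0 < C ∧ ∀ n : ℕ, 1 ≤ n → ∀ ν : ℝ, SolvesBalance d ψ r (1 + α) n ν →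
      ⨆ P ∈ smoothMarginClass d L α M ∩ tailClass d ψ ε₀ ∩ minimalMassClass d κ δ₀,
          ENNReal.ofReal (P.excessRisk (knnClassifier n ⌊ν⁻¹ ^ 2⌋₊)) ≤
        ENNReal.ofReal (C * ν ^ (1 + α)) := by
  -- With κa ≥ 8 and a ≤ a^d, the ball of radius aν has at least 4ν⁻² expected points, against k ≤
  -- ν⁻²; half of them still beats k by ν⁻².
  set a : ℝ := max 1 (8 / κ) with ha
  have ha1 : 1 ≤ a := le_max_left _ _
  have ha0 : 0 < a := by linarith
  -- An upper bound for t: below 1 to ensure k ≤ n, within ε₀ for the tail condition at t/2, and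
  -- inside (0, r).
  set s : ℝ := min 1 (min ε₀ (r / 2)) with hs
  have hs0 : 0 < s := lt_min one_pos (lt_min hε₀ (by linarith))
  have hs1 : s ≤ 1 := min_le_left _ _
  have hsε : s ≤ ε₀ := (min_le_right _ _).trans (min_le_left _ _)
  have hsr' : s ≤ r / 2 := (min_le_right _ _).trans (min_le_right _ _)
  have hsr : s < r := by linarith
  have hψs : 0 < ψ s := pos_of_tendsto_zero hψ hψ0 ⟨hs0, hsr⟩
  have hα1 : 0 < 1 + α := by linarith
  set ν₀ : ℝ := min 1 (min (δ₀ / a) (ψ s ^ (1 + α)⁻¹)) with hν₀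
  have hν₀0 : 0 < ν₀ := lt_min one_pos (lt_min (by positivity) (by positivity))
  set C₁ : ℝ := ⌈1 + α⌉₊.factorial * 2 ^ ⌈1 + α⌉₊
  set C₂ : ℝ := Real.exp ((L * a) ^ 2) * (2 * M * marginSum α)
  have hC₁ : 0 < C₁ := by positivity
  have hC₂ : 0 ≤ C₂ := by
    have := marginSum_nonneg α
    positivity
  have hν₀α : 0 < ν₀ ^ (1 + α) := by positivity
  refine ⟨1 + C₁ + C₂ + (ν₀ ^ (1 + α))⁻¹, by positivity, fun n hn ν ⟨hν, hbal⟩ => ?_⟩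
  refine iSup₂_le fun P hP => ENNReal.ofReal_le_ofReal ?_
  obtain ⟨⟨hP1, hP2⟩, hP3⟩ := hP
  have hνα : 0 < ν ^ (1 + α) := by positivity
  -- Above ν₀ the trivial bound 1 on the excess risk suffices, thanks to the last term of the
  -- constant.
  rcases le_or_gt ν ν₀ with hle | hgt
  swap
  · have h1 : ν₀ ^ (1 + α) ≤ ν ^ (1 + α) := by gcongr
    have h2 : 1 ≤ (ν₀ ^ (1 + α))⁻¹ * ν ^ (1 + α) := by
      rw [inv_mul_eq_div, one_le_div hν₀α]
      exact h1
    refine (P.excessRisk_le_one _).trans (h2.trans ?_)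
    gcongr
    linarith
  set t := tailInv ψ r (ν ^ (1 + α)) with ht
  have hν1 : ν ≤ 1 := hle.trans (min_le_left _ _)
  have hνδ : a * ν ≤ δ₀ := by
    have := hle.trans ((min_le_right _ _).trans (min_le_left _ _))
    rwa [le_div_iff₀ ha0, mul_comm] at this
  have hνψ : ν ^ (1 + α) ≤ ψ s := by
    have h1 := hle.trans ((min_le_right _ _).trans (min_le_right _ _))
    calc ν ^ (1 + α) ≤ (ψ s ^ (1 + α)⁻¹) ^ (1 + α) := by gcongr
      _ = ψ s := Real.rpow_inv_rpow hψs.le hα1.ne'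
  have hts : t ≤ s := tailInv_le hs0 hsr hνψ
  have ht0 : 0 < t := tailInv_pos hψ0 hνα hs0 hsr hνψ
  -- At t itself ψ may already have jumped above ν^(1+α); strictly below the infimum, at t/2, it has
  -- not.
  have htail : P.marginal.real {x | P.μ x < t / 2} ≤ ν ^ (1 + α) :=
    (hP2 (t / 2) (by linarith) (by linarith)).trans
      (lt_of_lt_tailInv (half_pos ht0) (by linarith : t / 2 < r) (half_lt_self ht0)).le
  have htν : ν ^ d * t ≤ 1 :=
    mul_le_one₀ (pow_le_one₀ hν.le hν1) ht0.le (hts.trans hs1)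
  have h := P.excessRisk_le (measurable_knnClassifier d n ⌊ν⁻¹ ^ 2⌋₊) hν hM.le
    (Real.exp_pos ((L * a) ^ 2)).le (Real.exp_pos (-(ν⁻¹ ^ 2 / 2))).le hP1.2 htail
    fun x hx hxt hΔ => disagree_knn_le_of_mem hd hL hκ hP1 hP3 hν hν1 ht0 hbal htν ha1
      (le_max_right _ _) hνδ hx hxt hΔ
  have h1 : Real.exp (-(ν⁻¹ ^ 2 / 2)) ≤ C₁ * ν ^ (1 + α) := exp_neg_inv_sq_le hν hν1
  have h2 : Real.exp ((L * a) ^ 2) * (2 * M * marginSum α * ν ^ (1 + α)) =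
      C₂ * ν ^ (1 + α) := by ring
  have h3 : 0 ≤ (ν₀ ^ (1 + α))⁻¹ * ν ^ (1 + α) := by positivity
  rw [h2] at h
  linarith

/-! ### The hypercube of models and its membership in the classes. -/

/-- The volume of the unit ball of `ℝ^d`. -/
noncomputable def unitBallVolume (d : ℕ) : ℝ :=
  (volume : Measure (EuclideanSpace ℝ (Fin d))).real (Metric.ball 0 1)

theorem unitBallVolume_pos (d : ℕ) : 0 < unitBallVolume d :=
  ENNReal.toReal_pos (Metric.measure_ball_pos _ _ one_pos).ne' measure_ball_lt_top.ne

theorem volume_real_ball_eq {d : ℕ} (x : EuclideanSpace ℝ (Fin d)) {r : ℝ} (hr : 0 < r) :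
    (volume : Measure (EuclideanSpace ℝ (Fin d))).real (Metric.ball x r) =
      r ^ d * unitBallVolume d := by
  rw [measureReal_def, Measure.addHaar_ball_of_pos _ _ hr, finrank_euclideanSpace_fin,
    ENNReal.toReal_mul, ENNReal.toReal_ofReal (by positivity), unitBallVolume, measureReal_def]

/-- A ball contains a ball of half the radius around each of its points. -/
theorem exists_ball_subset_inter {V : Type*} [NormedAddCommGroup V] [NormedSpace ℝ V] {p x : V}
    {R δ : ℝ} (hx : x ∈ Metric.ball p R) (hδ : 0 < δ) (hδR : δ ≤ 2 * R) :
    ∃ q, Metric.ball q (δ / 2) ⊆ Metric.ball x δ ∩ Metric.ball p R := by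
  rw [mem_ball_iff_norm] at hx
  suffices h : ∃ q, ‖q - x‖ ≤ δ / 2 ∧ ‖q - p‖ ≤ R - δ / 2 by
    obtain ⟨q, h1, h2⟩ := h
    refine ⟨q, subset_inter (Metric.ball_subset_ball' ?_) (Metric.ball_subset_ball' ?_)⟩
    · rw [dist_eq_norm]
      linarith
    · rw [dist_eq_norm]
      linarith
  rcases le_or_gt ‖x - p‖ (δ / 2) with h | h
  · exact ⟨p, by rwa [norm_sub_rev], by rw [sub_self, norm_zero]; linarith⟩
  · have h0 : 0 < ‖x - p‖ := by linarith
    -- The new center is x moved by δ/2 towards p.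
    refine ⟨x - (δ / 2 / ‖x - p‖) • (x - p), ?_, ?_⟩
    · rw [sub_sub_cancel_left, norm_neg, norm_smul, Real.norm_of_nonneg (by positivity),
        div_mul_cancel₀ _ h0.ne']
    · have h1 : x - (δ / 2 / ‖x - p‖) • (x - p) - p = (1 - δ / 2 / ‖x - p‖) • (x - p) := by
        rw [sub_smul, one_smul]
        abel
      rw [h1, norm_smul, Real.norm_of_nonneg, sub_mul, div_mul_cancel₀ _ h0.ne']
      · linarith
      · rw [sub_nonneg, div_le_one h0]
        exact h.le

/-- The geometric data of a family of models that are hard to tell apart: a ball `H` of high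
density, and well separated cells of low density on which the regression function is perturbed. -/
structure HypercubeDesign (d : ℕ) (ι : Type) [Fintype ι] where
  c : ι → EuclideanSpace ℝ (Fin d)
  p : EuclideanSpace ℝ (Fin d)
  ε : ℝ
  R : ℝ
  t : ℝ
  a : ℝ
  h : ℝ
  ε_pos : 0 < ε
  R_pos : 0 < R
  t_pos : 0 < t
  t_le : t ≤ a
  h_pos : 0 < h
  h_le : h ≤ 1 / 2
  sep_cells : ∀ z z', z ≠ z' → 4 * ε ≤ ‖c z - c z'‖
  sep_heavy : ∀ z, R + 4 * ε ≤ ‖c z - p‖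
  mass : a * (R ^ d * unitBallVolume d) +
    Fintype.card ι * (t * (ε ^ d * unitBallVolume d)) = 1

namespace HypercubeDesign

variable {d : ℕ} {ι : Type} [Fintype ι] (D : HypercubeDesign d ι)

theorem a_pos : 0 < D.a := D.t_pos.trans_le D.t_le

/-- The cells of low density. -/
def cell (z : ι) : Set (EuclideanSpace ℝ (Fin d)) := Metric.ball (D.c z) D.ε

/-- The ball of high density. -/
def heavy : Set (EuclideanSpace ℝ (Fin d)) := Metric.ball D.p D.R

theorem measurableSet_cell (z : ι) : MeasurableSet (D.cell z) := measurableSet_ball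

theorem measurableSet_heavy : MeasurableSet D.heavy := measurableSet_ball

theorem le_norm_of_mem_cell {z z' : ι} (hz : z ≠ z') {x y : EuclideanSpace ℝ (Fin d)}
    (hx : x ∈ D.cell z) (hy : y ∈ D.cell z') : 2 * D.ε ≤ ‖x - y‖ := by
  rw [cell, mem_ball_iff_norm'] at hx
  rw [cell, mem_ball_iff_norm] at hy
  have h := D.sep_cells z z' hz
  have h1 : D.c z - D.c z' = (D.c z - x) + (x - y) + (y - D.c z') := by abel
  have h2 := norm_add₃_le (a := D.c z - x) (b := x - y) (c := y - D.c z')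
  rw [← h1] at h2
  linarith

theorem le_norm_of_mem_heavy {z : ι} {x y : EuclideanSpace ℝ (Fin d)}
    (hx : x ∈ D.cell z) (hy : y ∈ D.heavy) : 2 * D.ε ≤ ‖x - y‖ := by
  rw [cell, mem_ball_iff_norm'] at hx
  rw [heavy, mem_ball_iff_norm] at hy
  have h := D.sep_heavy z
  have h1 : D.c z - D.p = (D.c z - x) + (x - y) + (y - D.p) := by abel
  have h2 := norm_add₃_le (a := D.c z - x) (b := x - y) (c := y - D.p)
  rw [← h1] at h2
  linarith [D.ε_pos]

theorem eq_of_mem_cell {z z' : ι} {x : EuclideanSpace ℝ (Fin d)} (hx : x ∈ D.cell z)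
    (hx' : x ∈ D.cell z') : z = z' := by
  by_contra h
  have := D.le_norm_of_mem_cell h hx hx'
  rw [sub_self, norm_zero] at this
  linarith [D.ε_pos]

theorem notMem_heavy {z : ι} {x : EuclideanSpace ℝ (Fin d)} (hx : x ∈ D.cell z) :
    x ∉ D.heavy := by
  intro h
  have := D.le_norm_of_mem_heavy hx h
  rw [sub_self, norm_zero] at this
  linarith [D.ε_pos]

/-- The function with value `w z` on the cell `z` and `0` elsewhere. -/
noncomputable def onCells (w : ι → ℝ) (x : EuclideanSpace ℝ (Fin d)) : ℝ :=
  ∑ z, (D.cell z).indicator (fun _ => w z) x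

theorem onCells_of_mem (w : ι → ℝ) {z : ι} {x : EuclideanSpace ℝ (Fin d)} (hx : x ∈ D.cell z) :
    D.onCells w x = w z := by
  rw [onCells, Finset.sum_eq_single z, indicator_of_mem hx]
  · intro z' _ hz'
    exact indicator_of_notMem (fun h => hz' (D.eq_of_mem_cell h hx)) _
  · simp

theorem onCells_of_notMem (w : ι → ℝ) {x : EuclideanSpace ℝ (Fin d)} (hx : ∀ z, x ∉ D.cell z) :
    D.onCells w x = 0 :=
  Finset.sum_eq_zero fun z _ => indicator_of_notMem (hx z) _

theorem measurable_onCells (w : ι → ℝ) : Measurable (D.onCells w) :=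
  Finset.measurable_sum _ fun z _ => measurable_const.indicator (D.measurableSet_cell z)

/-- The common density of the models. -/
noncomputable def density (x : EuclideanSpace ℝ (Fin d)) : ℝ :=
  D.heavy.indicator (fun _ => D.a) x + D.onCells (fun _ => D.t) x

theorem density_of_mem_cell {z : ι} {x : EuclideanSpace ℝ (Fin d)} (hx : x ∈ D.cell z) :
    D.density x = D.t := by
  rw [density, indicator_of_notMem (D.notMem_heavy hx), D.onCells_of_mem _ hx, zero_add]

theorem density_of_mem_heavy {x : EuclideanSpace ℝ (Fin d)} (hx : x ∈ D.heavy) :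
    D.density x = D.a := by
  rw [density, indicator_of_mem hx, D.onCells_of_notMem _ fun z hz => D.notMem_heavy hz hx,
    add_zero]

theorem density_of_notMem {x : EuclideanSpace ℝ (Fin d)} (hx : x ∉ D.heavy)
    (hx' : ∀ z, x ∉ D.cell z) : D.density x = 0 := by
  rw [density, indicator_of_notMem hx, D.onCells_of_notMem _ hx', add_zero]

theorem support_density : Function.support D.density = D.heavy ∪ ⋃ z, D.cell z := by
  ext x
  simp only [Function.mem_support, mem_union, mem_iUnion]
  constructor
  · intro h
    by_contra hc
    push Not at hc
    exact h (D.density_of_notMem hc.1 hc.2)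
  · rintro (h | ⟨z, h⟩)
    · rw [D.density_of_mem_heavy h]
      exact D.a_pos.ne'
    · rw [D.density_of_mem_cell h]
      exact D.t_pos.ne'

theorem density_nonneg (x : EuclideanSpace ℝ (Fin d)) : 0 ≤ D.density x := by
  by_cases h : x ∈ D.heavy
  · rw [D.density_of_mem_heavy h]
    exact D.a_pos.le
  by_cases h' : ∃ z, x ∈ D.cell z
  · obtain ⟨z, hz⟩ := h'
    rw [D.density_of_mem_cell hz]
    exact D.t_pos.le
  · rw [D.density_of_notMem h (not_exists.1 h')]

theorem measurable_density : Measurable D.density :=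
  (measurable_const.indicator D.measurableSet_heavy).add (D.measurable_onCells _)

theorem integral_density : ∫⁻ x, ENNReal.ofReal (D.density x) = 1 := by
  have hi1 : Integrable (D.heavy.indicator fun _ => D.a)
      (volume : Measure (EuclideanSpace ℝ (Fin d))) :=
    (integrable_indicator_iff D.measurableSet_heavy).2
      (integrableOn_const measure_ball_lt_top.ne)
  have hi2 : ∀ z ∈ Finset.univ, Integrable ((D.cell z).indicator fun _ => D.t)
      (volume : Measure (EuclideanSpace ℝ (Fin d))) := fun z _ =>
    (integrable_indicator_iff (D.measurableSet_cell z)).2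
      (integrableOn_const measure_ball_lt_top.ne)
  have hi3 : Integrable (D.onCells fun _ => D.t) volume := integrable_finsetSum _ hi2
  have hi : Integrable D.density volume := hi1.add hi3
  rw [← ofReal_integral_eq_lintegral_ofReal hi (ae_of_all _ D.density_nonneg),
    ← ENNReal.ofReal_one]
  congr 1
  calc ∫ x, D.density x
      = (∫ x, D.heavy.indicator (fun _ => D.a) x) + ∫ x, D.onCells (fun _ => D.t) x :=
        integral_add hi1 hi3
    _ = D.a * (D.R ^ d * unitBallVolume d) +
        Fintype.card ι * (D.t * (D.ε ^ d * unitBallVolume d)) := by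
      congr 1
      · rw [integral_indicator_const _ D.measurableSet_heavy, heavy,
          volume_real_ball_eq _ D.R_pos, smul_eq_mul, mul_comm]
      · simp only [onCells]
        rw [integral_finsetSum _ hi2]
        have hz : ∀ z, ∫ x, (D.cell z).indicator (fun _ => D.t) x =
            D.t * (D.ε ^ d * unitBallVolume d) := fun z => by
          rw [integral_indicator_const _ (D.measurableSet_cell z), cell,
            volume_real_ball_eq _ D.ε_pos, smul_eq_mul, mul_comm]
        simp only [hz, Finset.sum_const, Finset.card_univ, nsmul_eq_mul]
    _ = 1 := D.mass

theorem abs_coe_signType_le (s : SignType) : |(s : ℝ)| ≤ 1 := by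
  cases s <;> simp

/-- The model in which the regression function is `1/2 + σ z * h` on the cell `z`, and `1/2`
outside of the cells. -/
noncomputable def model (σ : ι → SignType) : ClassifModel d where
  μ := D.density
  η x := 1 / 2 + D.onCells (fun z => σ z * D.h) x
  measurable_μ := D.measurable_density
  measurable_η := measurable_const.add (D.measurable_onCells _)
  μ_nonneg := D.density_nonneg
  lintegral_μ := D.integral_density
  η_mem x := by
    by_cases h' : ∃ z, x ∈ D.cell z
    · obtain ⟨z, hz⟩ := h'
      rw [D.onCells_of_mem _ hz]
      have h1 : |(σ z : ℝ) * D.h| ≤ 1 / 2 := by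
        rw [abs_mul, abs_of_pos D.h_pos]
        exact (mul_le_of_le_one_left D.h_pos.le (abs_coe_signType_le _)).trans D.h_le
      rw [abs_le] at h1
      exact ⟨by linarith, by linarith⟩
    · rw [D.onCells_of_notMem _ (not_exists.1 h')]
      norm_num
  isOpen_support := by
    rw [D.support_density]
    exact Metric.isOpen_ball.union (isOpen_iUnion fun z => Metric.isOpen_ball)

theorem Ω_model (σ : ι → SignType) : (D.model σ).Ω = D.heavy ∪ ⋃ z, D.cell z := D.support_density

theorem eta_of_mem (σ : ι → SignType) {z : ι} {x : EuclideanSpace ℝ (Fin d)}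
    (hx : x ∈ D.cell z) : (D.model σ).η x = 1 / 2 + σ z * D.h := by
  simp only [model, D.onCells_of_mem _ hx]

theorem eta_of_notMem (σ : ι → SignType) {x : EuclideanSpace ℝ (Fin d)}
    (hx : ∀ z, x ∉ D.cell z) : (D.model σ).η x = 1 / 2 := by
  simp only [model, D.onCells_of_notMem _ hx, add_zero]

/-- The common law of the input. -/
noncomputable def inputLaw : Measure (EuclideanSpace ℝ (Fin d)) :=
  volume.withDensity fun x => ENNReal.ofReal (D.density x)

theorem marginal_model (σ : ι → SignType) : (D.model σ).marginal = D.inputLaw := rfl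

instance : IsProbabilityMeasure D.inputLaw :=
  inferInstanceAs (IsProbabilityMeasure (D.model 0).marginal)

theorem inputLaw_real_of_const {s : Set (EuclideanSpace ℝ (Fin d))} (hs : MeasurableSet s) {w : ℝ}
    (hw : 0 ≤ w) (h : ∀ x ∈ s, D.density x = w) :
    D.inputLaw.real s = w * (volume : Measure (EuclideanSpace ℝ (Fin d))).real s := by
  rw [measureReal_def, inputLaw, withDensity_apply _ hs,
    setLIntegral_congr_fun hs (g := fun _ => ENNReal.ofReal w)
      (fun x hx => by simp only [h x hx]), setLIntegral_const, ENNReal.toReal_mul,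
    ENNReal.toReal_ofReal hw, measureReal_def]

theorem inputLaw_real_ball_of_subset_heavy {q : EuclideanSpace ℝ (Fin d)} {ρ : ℝ} (hρ : 0 < ρ)
    (h : Metric.ball q ρ ⊆ D.heavy) :
    D.inputLaw.real (Metric.ball q ρ) = D.a * (ρ ^ d * unitBallVolume d) := by
  rw [D.inputLaw_real_of_const measurableSet_ball D.a_pos.le
    fun x hx => D.density_of_mem_heavy (h hx), volume_real_ball_eq _ hρ]

theorem inputLaw_real_ball_of_subset_cell {q : EuclideanSpace ℝ (Fin d)} {ρ : ℝ} (hρ : 0 < ρ)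
    {z : ι} (h : Metric.ball q ρ ⊆ D.cell z) :
    D.inputLaw.real (Metric.ball q ρ) = D.t * (ρ ^ d * unitBallVolume d) := by
  rw [D.inputLaw_real_of_const measurableSet_ball D.t_pos.le
    fun x hx => D.density_of_mem_cell (h hx), volume_real_ball_eq _ hρ]

theorem inputLaw_real_cell (z : ι) :
    D.inputLaw.real (D.cell z) = D.t * (D.ε ^ d * unitBallVolume d) :=
  D.inputLaw_real_ball_of_subset_cell D.ε_pos subset_rfl

/-- The total mass of the cells. -/
noncomputable def cellMass : ℝ := Fintype.card ι * (D.t * (D.ε ^ d * unitBallVolume d))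

theorem inputLaw_real_biUnion_cell (Z : Finset ι) :
    D.inputLaw.real (⋃ z ∈ Z, D.cell z) = Z.card * (D.t * (D.ε ^ d * unitBallVolume d)) := by
  rw [measureReal_biUnion_finset (fun z _ z' _ hz => disjoint_left.2
    fun x hx hx' => hz (D.eq_of_mem_cell hx hx')) fun z _ => D.measurableSet_cell z,
    Finset.sum_congr rfl fun z _ => D.inputLaw_real_cell z, Finset.sum_const, nsmul_eq_mul]

theorem inputLaw_real_iUnion_cell : D.inputLaw.real (⋃ z, D.cell z) = D.cellMass := by
  have := D.inputLaw_real_biUnion_cell Finset.univ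
  rw [cellMass]
  simpa only [Finset.mem_univ, iUnion_true, Finset.card_univ] using this

theorem ae_mem_support : ∀ᵐ x ∂D.inputLaw, x ∈ D.heavy ∪ ⋃ z, D.cell z := by
  have := (D.model 0).ae_mem_Ω
  rwa [D.Ω_model] at this

/-- The regression function is constant on each component of the support, and distinct components
are 2ε apart while it varies by at most 2h ≤ 2Lε. For the margin, |η - 1/2| takes only the values 0
and h, so all the mass to control is that of the cells, and only for levels above h. -/
theorem model_mem_smoothMarginClass (σ : ι → SignType) {L α M : ℝ} (hL : D.h ≤ L * D.ε)
    (hα : 0 < α) (hM : D.cellMass ≤ M * D.h ^ α) (hM0 : 0 ≤ M) :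
    D.model σ ∈ smoothMarginClass d L α M := by
  have hL0 : 0 < L := pos_of_mul_pos_left (D.h_pos.trans_le hL) D.ε_pos.le
  have hbd : ∀ x, |(D.model σ).η x - 1 / 2| ≤ D.h := by
    intro x
    by_cases h' : ∃ z, x ∈ D.cell z
    · obtain ⟨z, hz⟩ := h'
      rw [D.eta_of_mem σ hz, add_sub_cancel_left, abs_mul, abs_of_pos D.h_pos]
      exact mul_le_of_le_one_left D.h_pos.le (abs_coe_signType_le _)
    · rw [D.eta_of_notMem σ (not_exists.1 h'), sub_self, abs_zero]
      exact D.h_pos.le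
  constructor
  · intro x hx y hy
    rw [D.Ω_model] at hx hy
    have hfar : 2 * D.ε ≤ ‖x - y‖ → |(D.model σ).η x - (D.model σ).η y| ≤ L * ‖x - y‖ := by
      intro h
      have h1 := hbd x
      have h2 := hbd y
      have h3 : |(D.model σ).η x - (D.model σ).η y| ≤ 2 * D.h := by
        rw [abs_le] at h1 h2 ⊢
        constructor <;> linarith
      nlinarith
    have hsame : (D.model σ).η x = (D.model σ).η y →
        |(D.model σ).η x - (D.model σ).η y| ≤ L * ‖x - y‖ := by
      intro h
      rw [h, sub_self, abs_zero]
      positivity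
    have hheavy : ∀ {x}, x ∈ D.heavy → (D.model σ).η x = 1 / 2 := fun hx =>
      D.eta_of_notMem σ fun z hz => D.notMem_heavy hz hx
    rcases hx with hx | hx <;> rcases hy with hy | hy
    · exact hsame ((hheavy hx).trans (hheavy hy).symm)
    · obtain ⟨z, hz⟩ := mem_iUnion.1 hy
      refine hfar ?_
      rw [norm_sub_rev]
      exact D.le_norm_of_mem_heavy hz hx
    · obtain ⟨z, hz⟩ := mem_iUnion.1 hx
      exact hfar (D.le_norm_of_mem_heavy hz hy)
    · obtain ⟨z, hz⟩ := mem_iUnion.1 hx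
      obtain ⟨z', hz'⟩ := mem_iUnion.1 hy
      by_cases h : z = z'
      · subst h
        exact hsame ((D.eta_of_mem σ hz).trans (D.eta_of_mem σ hz').symm)
      · exact hfar (D.le_norm_of_mem_cell h hz hz')
  · intro s hs
    rw [D.marginal_model]
    have hcells : ∀ x, 0 < |(D.model σ).η x - 1 / 2| →
        x ∈ ⋃ z, D.cell z ∧ |(D.model σ).η x - 1 / 2| = D.h := by
      intro x hx
      by_cases h' : ∃ z, x ∈ D.cell z
      · refine ⟨mem_iUnion.2 h', ?_⟩
        obtain ⟨z, hz⟩ := h'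
        rw [D.eta_of_mem σ hz, add_sub_cancel_left, abs_mul, abs_of_pos D.h_pos] at hx ⊢
        rcases h : σ z with _ | _ | _
        · simp [h] at hx
        · simp
        · simp
      · rw [D.eta_of_notMem σ (not_exists.1 h'), sub_self, abs_zero] at hx
        exact absurd hx (lt_irrefl 0)
    rcases lt_or_ge D.h s with h | h
    · calc D.inputLaw.real _ ≤ D.inputLaw.real (⋃ z, D.cell z) :=
            measureReal_mono fun x hx => (hcells x hx.1).1
        _ = D.cellMass := D.inputLaw_real_iUnion_cell
        _ ≤ M * D.h ^ α := hM
        _ ≤ M * s ^ α := by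
          have := D.h_pos
          gcongr
    · have : {x | 0 < |(D.model σ).η x - 1 / 2| ∧ |(D.model σ).η x - 1 / 2| < s} = ∅ := by
        refine eq_empty_of_forall_notMem fun x hx => ?_
        have := hx.2
        rw [(hcells x hx.1).2] at this
        linarith
      rw [this, measureReal_empty]
      positivity

/-- Below the density of the heavy ball, only the cells can have low density, and only at levels
above t. -/
theorem model_mem_tailClass (σ : ι → SignType) {ψ : ℝ → ℝ} {ε₀ : ℝ} (hε₀ : ε₀ ≤ D.a)
    (h0 : ∀ e, 0 < e → e < ε₀ → 0 ≤ ψ e) (h1 : ∀ e, D.t < e → e < ε₀ → D.cellMass ≤ ψ e) :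
    D.model σ ∈ tailClass d ψ ε₀ := by
  intro e he he'
  rw [D.marginal_model]
  change D.inputLaw.real {x | D.density x < e} ≤ ψ e
  rcases lt_or_ge D.t e with h | h
  · refine le_trans ?_ (h1 e h he')
    rw [← D.inputLaw_real_iUnion_cell]
    refine ENNReal.toReal_mono (measure_ne_top _ _) (measure_mono_ae ?_)
    filter_upwards [D.ae_mem_support] with x hx hxe
    rcases hx with hx | hx
    · have hxe' : D.density x < e := hxe
      rw [D.density_of_mem_heavy hx] at hxe'
      linarith
    · exact hx
  · refine le_trans (le_of_eq ?_) (h0 e he he')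
    rw [measureReal_eq_zero_iff]
    refine measure_mono_null (t := (D.heavy ∪ ⋃ z, D.cell z)ᶜ) (fun x hxe hx => ?_)
      D.ae_mem_support
    have hxe' : D.density x < e := hxe
    rcases hx with hx | hx
    · rw [D.density_of_mem_heavy hx] at hxe'
      linarith
    · obtain ⟨z, hz⟩ := mem_iUnion.1 hx
      rw [D.density_of_mem_cell hz] at hxe'
      linarith

end HypercubeDesign

/-! ### Testing between two product measures. -/

theorem withDensity_ofReal_real {X : Type*} [MeasurableSpace X] {Q : Measure X} {F : X → ℝ}
    (hF : Integrable F Q) (h0 : ∀ x, 0 ≤ F x) {B : Set X} (hB : MeasurableSet B) :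
    (Q.withDensity fun x => ENNReal.ofReal (F x)).real B = ∫ x in B, F x ∂Q := by
  rw [measureReal_def, withDensity_apply _ hB,
    ← ofReal_integral_eq_lintegral_ofReal hF.integrableOn (ae_of_all _ h0),
    ENNReal.toReal_ofReal (integral_nonneg h0)]

/-- The `n`-fold product of the measure with density `f` with respect to `Q`. -/
theorem pi_withDensity_ofReal {X : Type*} [MeasurableSpace X] (Q : Measure X)
    [IsProbabilityMeasure Q] {f : X → ℝ} (hf : Measurable f) (h0 : ∀ x, 0 ≤ f x)
    [IsProbabilityMeasure (Q.withDensity fun x => ENNReal.ofReal (f x))] (n : ℕ) :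
    (Measure.pi fun _ : Fin n => Q.withDensity fun x => ENNReal.ofReal (f x)) =
      (Measure.pi fun _ : Fin n => Q).withDensity fun S => ENNReal.ofReal (∏ i, f (S i)) := by
  rw [pi_withDensity (fun _ : Fin n => Q) (fun _ x => ENNReal.ofReal (f x))
    fun _ => hf.ennreal_ofReal]
  congr 1
  funext S
  rw [ENNReal.ofReal_prod_of_nonneg fun i _ => h0 _]

/-- Bernoulli's inequality on one side and exp(x) ≤ 1 + 2x on the other bound the difference by 6nq.
-/
theorem pow_sub_pow_le {q : ℝ} {n : ℕ} (hq0 : 0 ≤ q) (hq1 : q ≤ 1) (hn : n * q ≤ 1 / 24) :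
    2 * (1 + q) ^ n - 2 * (1 - q) ^ n ≤ 1 / 4 := by
  have hnq : 0 ≤ n * q := by positivity
  have h1 : 1 + n * (-q) ≤ (1 + -q) ^ n := one_add_mul_le_pow (by linarith) n
  have h2 : (1 + q) ^ n ≤ 1 + 2 * (n * q) := by
    have h3 : (1 + q) ^ n ≤ Real.exp (n * q) := by
      rw [Real.exp_nat_mul]
      refine pow_le_pow_left₀ (by linarith) ?_ n
      linarith [Real.add_one_le_exp q]
    have h4 := Real.abs_exp_sub_one_le (x := n * q) (by rw [abs_of_nonneg hnq]; linarith)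
    rw [abs_of_nonneg hnq] at h4
    linarith [(abs_le.1 h4).2]
  rw [← sub_eq_add_neg] at h1
  linarith

/-- Two product measures with densities `∏ (1 + u)` and `∏ (1 - u)` cannot be told apart when `u`
is small in mean square. -/
theorem half_le_error_add_error {X : Type*} [MeasurableSpace X] (Q Qp Qm : Measure X)
    [IsProbabilityMeasure Q] [IsProbabilityMeasure Qp] [IsProbabilityMeasure Qm] {u : X → ℝ}
    (hu : Measurable u) (hu1 : ∀ x, |u x| ≤ 1) (hu0 : ∫ x, u x ∂Q = 0)
    (hp : Qp = Q.withDensity fun x => ENNReal.ofReal (1 + u x))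
    (hm : Qm = Q.withDensity fun x => ENNReal.ofReal (1 - u x)) {n : ℕ}
    (hn : n * ∫ x, u x ^ 2 ∂Q ≤ 1 / 24) {B : Set (Fin n → X)} (hB : MeasurableSet B) :
    1 / 2 ≤ (Measure.pi fun _ => Qp).real B + (Measure.pi fun _ => Qm).real Bᶜ := by
  have hui : Integrable u Q := Integrable.of_bound (C := 1) hu.aestronglyMeasurable
    (ae_of_all _ hu1)
  have hu2 : ∀ x, u x ^ 2 ≤ 1 := fun x => (sq_le_one_iff_abs_le_one _).2 (hu1 x)
  have hui2 : Integrable (fun x => u x ^ 2) Q := Integrable.of_bound (C := 1)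
    (hu.pow_const 2).aestronglyMeasurable (ae_of_all _ fun x => by
      rw [Real.norm_eq_abs, abs_of_nonneg (sq_nonneg _)]; exact hu2 x)
  set q := ∫ x, u x ^ 2 ∂Q with hq
  have hq0 : 0 ≤ q := integral_nonneg fun x => sq_nonneg _
  have hq1 : q ≤ 1 := by
    have := integral_mono hui2 (integrable_const (1 : ℝ)) hu2
    simpa using this
  set Fp : (Fin n → X) → ℝ := fun S => ∏ i, (1 + u (S i)) with hFp
  set Fm : (Fin n → X) → ℝ := fun S => ∏ i, (1 - u (S i)) with hFm
  have hpm : ∀ x, 0 ≤ 1 + u x ∧ 1 + u x ≤ 2 := fun x => by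
    have := abs_le.1 (hu1 x)
    exact ⟨by linarith, by linarith⟩
  have hmm : ∀ x, 0 ≤ 1 - u x ∧ 1 - u x ≤ 2 := fun x => by
    have := abs_le.1 (hu1 x)
    exact ⟨by linarith, by linarith⟩
  have hFp0 : ∀ S, 0 ≤ Fp S := fun S => Finset.prod_nonneg fun i _ => (hpm _).1
  have hFm0 : ∀ S, 0 ≤ Fm S := fun S => Finset.prod_nonneg fun i _ => (hmm _).1
  have hFp2 : ∀ S, Fp S ≤ 2 ^ n := fun S =>
    (Finset.prod_le_prod (fun i _ => (hpm _).1) fun i _ => (hpm (S i)).2).trans_eq (by simp)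
  have hFm2 : ∀ S, Fm S ≤ 2 ^ n := fun S =>
    (Finset.prod_le_prod (fun i _ => (hmm _).1) fun i _ => (hmm (S i)).2).trans_eq (by simp)
  have hFpm : Measurable Fp := Finset.measurable_prod _ fun i _ =>
    measurable_const.add (hu.comp (measurable_pi_apply i))
  have hFmm : Measurable Fm := Finset.measurable_prod _ fun i _ =>
    measurable_const.sub (hu.comp (measurable_pi_apply i))
  have hint : ∀ {F G : (Fin n → X) → ℝ}, Measurable F → Measurable G →
      (∀ S, 0 ≤ F S) → (∀ S, 0 ≤ G S) → (∀ S, F S ≤ 2 ^ n) → (∀ S, G S ≤ 2 ^ n) →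
      Integrable (fun S => F S * G S) (Measure.pi fun _ => Q) := by
    intro F G hF hG hF0 hG0 hF2 hG2
    refine Integrable.of_bound (C := 2 ^ n * 2 ^ n) (hF.mul hG).aestronglyMeasurable
      (ae_of_all _ fun S => ?_)
    rw [Real.norm_eq_abs, abs_of_nonneg (mul_nonneg (hF0 S) (hG0 S))]
    exact mul_le_mul (hF2 S) (hG2 S) (hG0 S) (by positivity)
  have h1n : (1 : ℝ) ≤ 2 ^ n := one_le_pow₀ one_le_two
  have hFpi : Integrable Fp (Measure.pi fun _ => Q) := by
    simpa using hint hFpm measurable_one hFp0 (fun _ => zero_le_one) hFp2 fun _ => h1n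
  have hFmi : Integrable Fm (Measure.pi fun _ => Q) := by
    simpa using hint hFmm measurable_one hFm0 (fun _ => zero_le_one) hFm2 fun _ => h1n
  have hpp := hint hFpm hFpm hFp0 hFp0 hFp2 hFp2
  have hmm' := hint hFmm hFmm hFm0 hFm0 hFm2 hFm2
  have hpm' := hint hFpm hFmm hFp0 hFm0 hFp2 hFm2
  have hadd : Integrable (fun x => 1 + 2 * u x) Q := (integrable_const _).add (hui.const_mul 2)
  have hsub : Integrable (fun x => 1 - 2 * u x) Q := (integrable_const _).sub (hui.const_mul 2)
  have e1 : ∫ S, Fp S * Fp S ∂(Measure.pi fun _ => Q) = (1 + q) ^ n := by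
    have h : ∀ S, Fp S * Fp S = ∏ i, (1 + 2 * u (S i) + u (S i) ^ 2) := fun S => by
      rw [← Finset.prod_mul_distrib]
      exact Finset.prod_congr rfl fun i _ => by ring
    simp_rw [h]
    rw [integral_fintype_prod_eq_pow (fun x => 1 + 2 * u x + u x ^ 2), Fintype.card_fin,
      integral_add hadd hui2,
      integral_add (integrable_const _) (hui.const_mul 2), integral_const_mul, hu0]
    simp [← hq]
  have e2 : ∫ S, Fm S * Fm S ∂(Measure.pi fun _ => Q) = (1 + q) ^ n := by
    have h : ∀ S, Fm S * Fm S = ∏ i, (1 - 2 * u (S i) + u (S i) ^ 2) := fun S => by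
      rw [← Finset.prod_mul_distrib]
      exact Finset.prod_congr rfl fun i _ => by ring
    simp_rw [h]
    rw [integral_fintype_prod_eq_pow (fun x => 1 - 2 * u x + u x ^ 2), Fintype.card_fin,
      integral_add hsub hui2,
      integral_sub (integrable_const _) (hui.const_mul 2), integral_const_mul, hu0]
    simp [← hq]
  have e3 : ∫ S, Fp S * Fm S ∂(Measure.pi fun _ => Q) = (1 - q) ^ n := by
    have h : ∀ S, Fp S * Fm S = ∏ i, (1 - u (S i) ^ 2) := fun S => by
      rw [← Finset.prod_mul_distrib]
      exact Finset.prod_congr rfl fun i _ => by ring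
    simp_rw [h]
    rw [integral_fintype_prod_eq_pow (fun x => 1 - u x ^ 2), Fintype.card_fin,
      integral_sub (integrable_const _) hui2]
    simp [← hq]
  -- Each term of the expanded square is a product over coordinates, and u has mean 0, so the
  -- integral is exactly 2(1+q)^n - 2(1-q)^n.
  have hsq : ∀ S, (Fm S - Fp S) ^ 2 = Fm S * Fm S + Fp S * Fp S - 2 * (Fp S * Fm S) := fun S => by
    ring
  have hsqi : Integrable (fun S => (Fm S - Fp S) ^ 2) (Measure.pi fun _ => Q) := by
    simp_rw [hsq]
    exact (hmm'.add hpp).sub (hpm'.const_mul 2)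
  have e4 : ∫ S, (Fm S - Fp S) ^ 2 ∂(Measure.pi fun _ => Q) ≤ 1 / 4 := by
    simp_rw [hsq]
    have hsum : Integrable (fun S => Fm S * Fm S + Fp S * Fp S) (Measure.pi fun _ => Q) :=
      hmm'.add hpp
    rw [integral_sub hsum (hpm'.const_mul 2), integral_add hmm' hpp, integral_const_mul,
      e1, e2, e3]
    have := pow_sub_pow_le hq0 hq1 hn
    linarith
  have hQp : (Measure.pi fun _ : Fin n => Qp).real B = ∫ S in B, Fp S ∂(Measure.pi fun _ => Q) := by
    subst hp
    rw [pi_withDensity_ofReal Q (f := fun x => 1 + u x) (measurable_const.add hu) fun x => (hpm x).1]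
    exact withDensity_ofReal_real hFpi hFp0 hB
  have hQm : (Measure.pi fun _ : Fin n => Qm).real B = ∫ S in B, Fm S ∂(Measure.pi fun _ => Q) := by
    subst hm
    rw [pi_withDensity_ofReal Q (f := fun x => 1 - u x) (measurable_const.sub hu) fun x => (hmm x).1]
    exact withDensity_ofReal_real hFmi hFm0 hB
  -- The inequality x ≤ 1/4 + x² replaces the Cauchy-Schwarz bound on the total variation.
  have hkey : (∫ S in B, Fm S ∂(Measure.pi fun _ => Q)) - ∫ S in B, Fp S ∂(Measure.pi fun _ => Q) ≤
      1 / 4 + ∫ S, (Fm S - Fp S) ^ 2 ∂(Measure.pi fun _ => Q) := by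
    have hi : Integrable (fun S => 1 / 4 + (Fm S - Fp S) ^ 2) (Measure.pi fun _ => Q) :=
      (integrable_const _).add hsqi
    rw [← integral_sub hFmi.integrableOn hFpi.integrableOn]
    calc ∫ S in B, (Fm S - Fp S) ∂(Measure.pi fun _ => Q)
        ≤ ∫ S in B, (1 / 4 + (Fm S - Fp S) ^ 2) ∂(Measure.pi fun _ => Q) :=
          integral_mono (hFmi.sub hFpi).integrableOn hi.integrableOn
            fun S => by nlinarith [sq_nonneg (Fm S - Fp S - 1 / 2)]
      _ ≤ ∫ S, (1 / 4 + (Fm S - Fp S) ^ 2) ∂(Measure.pi fun _ => Q) :=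
          setIntegral_le_integral hi (ae_of_all _ fun S => by positivity)
      _ = _ := by
          rw [integral_add (integrable_const _) hsqi]
          simp
  rw [probReal_compl_eq_one_sub hB, hQp, hQm]
  linarith

/-! ### Averaging over the hypercube. -/

namespace HypercubeDesign

/-- The signs that correspond to a vertex of the hypercube. -/
def vertex {ι : Type} (τ : ι → Bool) (z : ι) : SignType := if τ z = true then 1 else -1

theorem vertex_update {ι : Type} [DecidableEq ι] (τ : ι → Bool) (z : ι) (b : Bool) :
    vertex (Function.update τ z b) = Function.update (vertex τ) z (if b = true then 1 else -1) := by
  funext z'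
  by_cases h : z' = z
  · subst h
    simp [vertex]
  · simp [vertex, h]

variable {d : ℕ} {ι : Type} [Fintype ι] (D : HypercubeDesign d ι)

/-- The relative perturbation of the law caused by the cell `z`. -/
noncomputable def bump (z : ι) (w : EuclideanSpace ℝ (Fin d) × Bool) : ℝ :=
  (D.cell z).indicator (fun _ => 2 * D.h) w.1 * if w.2 = true then 1 else -1

theorem measurable_bump (z : ι) : Measurable (D.bump z) :=
  ((measurable_const.indicator (D.measurableSet_cell z)).comp measurable_fst).mul
    (Measurable.ite (measurable_snd (measurableSet_singleton true)) measurable_const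
      measurable_const)

theorem abs_bump_le (z : ι) (w : EuclideanSpace ℝ (Fin d) × Bool) : |D.bump z w| ≤ 1 := by
  have h1 := D.h_pos
  have h2 := D.h_le
  rw [bump, abs_mul]
  have h3 : |if w.2 = true then (1 : ℝ) else -1| = 1 := by split_ifs <;> simp
  rw [h3, mul_one]
  by_cases h : w.1 ∈ D.cell z
  · rw [indicator_of_mem h, abs_of_pos (by linarith)]
    linarith
  · rw [indicator_of_notMem h, abs_zero]
    exact zero_le_one

theorem bayes_vertex (τ : ι → Bool) {z : ι} {x : EuclideanSpace ℝ (Fin d)} (hx : x ∈ D.cell z) :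
    (D.model (vertex τ)).bayes x = τ z := by
  have h := D.eta_of_mem (vertex τ) hx
  have hp := D.h_pos
  rcases Bool.eq_false_or_eq_true (τ z) with hz | hz
  · rw [hz]
    refine ClassifModel.bayes_eq_true _ ?_
    rw [h, vertex, hz]
    simpa using hp
  · rw [hz]
    refine ClassifModel.bayes_eq_false _ ?_
    rw [h, vertex, hz]
    simpa using hp.le

variable [DecidableEq ι]

/-- Two models differing in one cell are compared through the model with sign 0 there, where η =
1/2: relative to it, both signs are the perturbations 1 ± u required by `half_le_error_add_error`.
-/
theorem law_update (σ : ι → SignType) (z : ι) (s : SignType) :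
    (D.model (Function.update σ z s)).law = (D.model (Function.update σ z 0)).law.withDensity
      fun w => ENNReal.ofReal (1 + s * D.bump z w) := by
  ext A hA
  have hm : Measurable fun w => ENNReal.ofReal (1 + s * D.bump z w) :=
    (measurable_const.add ((D.measurable_bump z).const_mul _)).ennreal_ofReal
  rw [withDensity_apply _ hA, ← lintegral_indicator hA, ← lintegral_indicator_one hA,
    ClassifModel.lintegral_law _ (measurable_one.indicator hA),
    ClassifModel.lintegral_law _ (hm.indicator hA)]
  simp only [D.marginal_model]
  refine lintegral_congr fun x => ?_
  have key : ENNReal.ofReal ((D.model (Function.update σ z s)).η x) =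
        ENNReal.ofReal ((D.model (Function.update σ z 0)).η x) *
          ENNReal.ofReal (1 + s * D.bump z (x, true)) ∧
      ENNReal.ofReal (1 - (D.model (Function.update σ z s)).η x) =
        ENNReal.ofReal (1 - (D.model (Function.update σ z 0)).η x) *
          ENNReal.ofReal (1 + s * D.bump z (x, false)) := by
    have h0 := (D.model (Function.update σ z 0)).η_mem x
    rw [← ENNReal.ofReal_mul h0.1, ← ENNReal.ofReal_mul (by linarith [h0.2])]
    by_cases hx : x ∈ D.cell z
    · simp only [D.eta_of_mem _ hx, Function.update_self, bump, indicator_of_mem hx, if_true,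
        Bool.false_eq_true, if_false, SignType.coe_zero]
      constructor <;> congr 1 <;> ring
    · have he : (D.model (Function.update σ z s)).η x = (D.model (Function.update σ z 0)).η x := by
        by_cases h' : ∃ z', x ∈ D.cell z'
        · obtain ⟨z', hz'⟩ := h'
          have hne : z' ≠ z := fun h => hx (h ▸ hz')
          rw [D.eta_of_mem _ hz', D.eta_of_mem _ hz', Function.update_of_ne hne,
            Function.update_of_ne hne]
        · rw [D.eta_of_notMem _ (not_exists.1 h'), D.eta_of_notMem _ (not_exists.1 h')]
      rw [he]
      simp [bump, hx]
  rw [key.1, key.2]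
  by_cases h1 : (x, true) ∈ A <;> by_cases h2 : (x, false) ∈ A <;> simp [h1, h2]

theorem integral_bump (σ : ι → SignType) (z : ι) :
    ∫ w, D.bump z w ∂(D.model (Function.update σ z 0)).law = 0 := by
  -- Adding 1 makes the integrand nonnegative, as `integral_law` requires.
  have h1 := ClassifModel.integral_law (D.model (Function.update σ z 0))
    (f := fun w => 1 + D.bump z w) (measurable_const.add (D.measurable_bump z))
    fun w => by linarith [(abs_le.1 (D.abs_bump_le z w)).1]
  have h2 : ∀ x, (D.model (Function.update σ z 0)).η x * (1 + D.bump z (x, true)) +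
      (1 - (D.model (Function.update σ z 0)).η x) * (1 + D.bump z (x, false)) = 1 := by
    intro x
    by_cases hx : x ∈ D.cell z
    · simp only [D.eta_of_mem _ hx, Function.update_self, bump, indicator_of_mem hx, if_true,
        Bool.false_eq_true, if_false, SignType.coe_zero]
      ring
    · simp [bump, hx]
  simp_rw [h2] at h1
  rw [integral_add (integrable_const _) (Integrable.of_bound (C := 1)
    (D.measurable_bump z).aestronglyMeasurable (ae_of_all _ (D.abs_bump_le z)))] at h1
  simp only [integral_const, probReal_univ, smul_eq_mul, mul_one] at h1
  linarith

theorem integral_bump_sq (σ : ι → SignType) (z : ι) :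
    ∫ w, D.bump z w ^ 2 ∂(D.model (Function.update σ z 0)).law =
      4 * D.h ^ 2 * (D.t * (D.ε ^ d * unitBallVolume d)) := by
  rw [ClassifModel.integral_law _ (f := fun w => D.bump z w ^ 2) ((D.measurable_bump z).pow_const 2)
    fun w => sq_nonneg _, D.marginal_model]
  have h2 : ∀ x, (D.model (Function.update σ z 0)).η x * D.bump z (x, true) ^ 2 +
      (1 - (D.model (Function.update σ z 0)).η x) * D.bump z (x, false) ^ 2 =
      (D.cell z).indicator (fun _ => 4 * D.h ^ 2) x := by
    intro x
    by_cases hx : x ∈ D.cell z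
    · simp only [bump, indicator_of_mem hx, if_true, Bool.false_eq_true, if_false]
      ring
    · simp [bump, hx]
  simp_rw [h2]
  rw [integral_indicator_const _ (D.measurableSet_cell z), D.inputLaw_real_cell, smul_eq_mul,
    mul_comm]

variable {n : ℕ} {Φ : (Fin n → EuclideanSpace ℝ (Fin d) × Bool) → EuclideanSpace ℝ (Fin d) → Bool}

/-- For fixed x in the cell z, the answer at x is a test of the sign of that cell, and the two
disagreement probabilities are its two errors. -/
theorem half_le_disagree_add (hΦ : Measurable (Function.uncurry Φ))
    (hn : n * (4 * D.h ^ 2 * (D.t * (D.ε ^ d * unitBallVolume d))) ≤ 1 / 24) (τ : ι → Bool) {z : ι}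
    {x : EuclideanSpace ℝ (Fin d)} (hx : x ∈ D.cell z) :
    1 / 2 ≤ (D.model (vertex (Function.update τ z true))).disagree Φ x +
      (D.model (vertex (Function.update τ z false))).disagree Φ x := by
  have hB : MeasurableSet {S | Φ S x ≠ true} :=
    (measurableSet_eq_fun (f := fun S => Φ S x) (hΦ.comp (measurable_id.prodMk measurable_const))
      measurable_const).compl
  have h := half_le_error_add_error (D.model (Function.update (vertex τ) z 0)).law
    (D.model (Function.update (vertex τ) z 1)).law (D.model (Function.update (vertex τ) z (-1))).law
    (D.measurable_bump z) (D.abs_bump_le z) (D.integral_bump (vertex τ) z)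
    (by simpa using D.law_update (vertex τ) z 1)
    (by simpa [sub_eq_add_neg] using D.law_update (vertex τ) z (-1)) (n := n)
    (by rw [D.integral_bump_sq]; exact hn) hB
  refine h.trans_eq ?_
  congr 1
  · rw [ClassifModel.disagree, D.bayes_vertex _ hx, vertex_update, Function.update_self, if_pos rfl]
  · rw [ClassifModel.disagree, D.bayes_vertex _ hx, vertex_update, Function.update_self,
      if_neg Bool.false_ne_true]
    congr 1
    ext S
    simp

/-- Flipping the sign of the cell z is an involution of the vertices, so the sum can be paired with
itself: each pair contributes at least 1/2. -/
theorem pow_card_le_sum_disagree (hΦ : Measurable (Function.uncurry Φ))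
    (hn : n * (4 * D.h ^ 2 * (D.t * (D.ε ^ d * unitBallVolume d))) ≤ 1 / 24) {z : ι}
    {x : EuclideanSpace ℝ (Fin d)} (hx : x ∈ D.cell z) :
    2 ^ Fintype.card ι * (1 / 4) ≤ ∑ τ : ι → Bool, (D.model (vertex τ)).disagree Φ x := by
  set f : (ι → Bool) → ℝ := fun τ => (D.model (vertex τ)).disagree Φ x with hf
  have hinv : Function.Involutive fun τ : ι → Bool => Function.update τ z (!τ z) := by
    intro τ
    simp
  have h1 : ∑ τ, f (Function.update τ z (!τ z)) = ∑ τ, f τ :=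
    Equiv.sum_comp hinv.toPerm f
  have h2 : ∀ τ, 1 / 2 ≤ f τ + f (Function.update τ z (!τ z)) := by
    intro τ
    have h := D.half_le_disagree_add hΦ hn τ hx
    rcases Bool.eq_false_or_eq_true (τ z) with hz | hz
    · have : Function.update τ z true = τ := by rw [← hz, Function.update_eq_self]
      rw [this] at h
      simpa [hf, hz] using h
    · have : Function.update τ z false = τ := by rw [← hz, Function.update_eq_self]
      rw [this, add_comm] at h
      simpa [hf, hz] using h
  have h3 := Finset.sum_le_sum fun τ (_ : τ ∈ Finset.univ) => h2 τ
  rw [Finset.sum_add_distrib, h1, Finset.sum_const, Finset.card_univ, Fintype.card_fun,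
    Fintype.card_bool, nsmul_eq_mul] at h3
  push_cast at h3
  linarith

/-- Some vertex of the hypercube has a large excess risk. -/
theorem exists_excessRisk_ge (hΦ : Measurable (Function.uncurry Φ))
    (hn : n * (4 * D.h ^ 2 * (D.t * (D.ε ^ d * unitBallVolume d))) ≤ 1 / 24) :
    ∃ τ : ι → Bool, D.h * D.cellMass / 2 ≤ (D.model (vertex τ)).excessRisk Φ := by
  have hmeas : ∀ τ : ι → Bool, Measurable ((D.model (vertex τ)).disagree Φ) := fun τ =>
    ClassifModel.measurable_disagree _ hΦ
  have hh := D.h_pos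
  have hint : ∀ τ : ι → Bool, Integrable (fun x => 2 * D.h * (D.model (vertex τ)).disagree Φ x)
      D.inputLaw := fun τ => by
    refine Integrable.of_bound (C := 2 * D.h) ((hmeas τ).const_mul _).aestronglyMeasurable
      (ae_of_all _ fun x => ?_)
    rw [Real.norm_eq_abs, abs_of_nonneg (mul_nonneg (by linarith)
      (ClassifModel.disagree_nonneg _ _ _))]
    exact mul_le_of_le_one_right (by linarith) (ClassifModel.disagree_le_one _ _ _)
  have h1 : ∀ τ : ι → Bool,
      ∑ z, ∫ x in D.cell z, 2 * D.h * (D.model (vertex τ)).disagree Φ x ∂D.inputLaw ≤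
        (D.model (vertex τ)).excessRisk Φ := by
    intro τ
    rw [ClassifModel.excessRisk_eq _ hΦ, D.marginal_model,
      ← integral_iUnion_fintype (fun z => D.measurableSet_cell z)
        (fun z z' hz => disjoint_left.2 fun x hx hx' => hz (D.eq_of_mem_cell hx hx'))
        fun z => (hint τ).integrableOn]
    have hU : MeasurableSet (⋃ z, D.cell z) := MeasurableSet.iUnion D.measurableSet_cell
    have hηm := (D.model (vertex τ)).measurable_η
    have hi : Integrable (fun x => |2 * (D.model (vertex τ)).η x - 1| *
        (D.model (vertex τ)).disagree Φ x) D.inputLaw := by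
      have := hmeas τ
      refine Integrable.of_bound (C := 1) (Measurable.aestronglyMeasurable (by fun_prop))
        (ae_of_all _ fun x => ?_)
      rw [Real.norm_eq_abs, abs_of_nonneg (mul_nonneg (abs_nonneg _)
        (ClassifModel.disagree_nonneg _ _ _))]
      refine mul_le_one₀ ?_ (ClassifModel.disagree_nonneg _ _ _)
        (ClassifModel.disagree_le_one _ _ _)
      have := (D.model (vertex τ)).η_mem x
      exact abs_le.2 ⟨by linarith [this.1], by linarith [this.2]⟩
    refine le_trans (setIntegral_mono_on (hint τ).integrableOn hi.integrableOn hU fun x hx => ?_)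
      (setIntegral_le_integral hi (ae_of_all _ fun x => mul_nonneg (abs_nonneg _)
        (ClassifModel.disagree_nonneg _ _ _)))
    obtain ⟨z, hz⟩ := mem_iUnion.1 hx
    refine mul_le_mul_of_nonneg_right ?_ (ClassifModel.disagree_nonneg _ _ _)
    rw [D.eta_of_mem _ hz, vertex]
    split_ifs
    · simp only [SignType.coe_one]
      refine le_trans (le_of_eq ?_) (le_abs_self _)
      ring
    · simp only [SignType.coe_neg, SignType.coe_one]
      refine le_trans (le_of_eq ?_) (neg_le_abs _)
      ring
  have h2 : ∀ z, 2 * D.h * (2 ^ Fintype.card ι * (1 / 4)) * D.inputLaw.real (D.cell z) ≤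
      ∑ τ : ι → Bool, ∫ x in D.cell z, 2 * D.h * (D.model (vertex τ)).disagree Φ x ∂D.inputLaw := by
    intro z
    rw [← integral_finsetSum _ fun τ _ => (hint τ).integrableOn, mul_comm _ (D.inputLaw.real _),
      ← smul_eq_mul, ← setIntegral_const]
    refine setIntegral_mono_on (integrable_const _).integrableOn
      (integrable_finsetSum _ fun τ _ => hint τ).integrableOn (D.measurableSet_cell z)
      fun x hx => ?_
    rw [← Finset.mul_sum]
    exact mul_le_mul_of_nonneg_left (D.pow_card_le_sum_disagree hΦ hn hx) (by linarith)
  have h3 : ∑ _τ : ι → Bool, D.h * D.cellMass / 2 ≤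
      ∑ τ : ι → Bool, (D.model (vertex τ)).excessRisk Φ := by
    refine le_trans ?_ (Finset.sum_le_sum fun τ _ => h1 τ)
    rw [Finset.sum_comm]
    refine le_trans (le_of_eq ?_) (Finset.sum_le_sum fun z _ => h2 z)
    simp only [D.inputLaw_real_cell]
    rw [Finset.sum_const, Finset.sum_const, Finset.card_univ, Finset.card_univ, Fintype.card_fun,
      Fintype.card_bool, cellMass, nsmul_eq_mul, nsmul_eq_mul]
    push_cast
    ring
  obtain ⟨τ, -, hτ⟩ := Finset.exists_le_of_sum_le Finset.univ_nonempty h3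
  exact ⟨τ, hτ⟩

end HypercubeDesign

/-! ### The grid of cells and strong minimal mass. -/

theorem norm_le_card_mul {d : ℕ} (x : EuclideanSpace ℝ (Fin d)) {B : ℝ} (hB : 0 ≤ B)
    (h : ∀ i, |x i| ≤ B) : ‖x‖ ≤ d * B := by
  rw [EuclideanSpace.norm_eq, Real.sqrt_le_iff]
  refine ⟨by positivity, ?_⟩
  have h1 : ∀ i ∈ Finset.univ, ‖x i‖ ^ 2 ≤ B ^ 2 := fun i _ =>
    pow_le_pow_left₀ (norm_nonneg _) (h i) 2
  refine (Finset.sum_le_sum h1).trans ?_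
  rw [Finset.sum_const, Finset.card_univ, Fintype.card_fin, nsmul_eq_mul, mul_pow]
  have h2 : (d : ℝ) ≤ (d : ℝ) ^ 2 := by exact_mod_cast Nat.le_self_pow two_ne_zero d
  gcongr

theorem abs_apply_le_norm {d : ℕ} (x : EuclideanSpace ℝ (Fin d)) (i : Fin d) : |x i| ≤ ‖x‖ :=
  PiLp.norm_apply_le x i

/-- The number of integers of `{0, …, N - 1}` at distance at most `j` from one of them. -/
theorem min_le_card_filter {N : ℕ} (z : Fin N) (j : ℕ) :
    min (j + 1) N ≤
      (Finset.univ.filter fun z' : Fin N => |((z' : ℕ) : ℤ) - (z : ℕ)| ≤ j).card := by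
  set m := min (j + 1) N with hm
  have hz := z.2
  -- A window of m consecutive integers containing z: it starts at z, or is pushed left when z is
  -- too close to N.
  have hlt : ∀ i : Fin m, min (z : ℕ) (N - m) + i < N := fun i => by
    have := i.2
    omega
  have h := Finset.card_le_card_of_injOn (s := (Finset.univ : Finset (Fin m)))
    (t := Finset.univ.filter fun z' : Fin N => |((z' : ℕ) : ℤ) - (z : ℕ)| ≤ j)
    (fun i => ⟨min (z : ℕ) (N - m) + i, hlt i⟩) (fun i _ => ?_) (fun i _ i' _ hii => ?_)
  · simpa using h
  · have := i.2
    simp only [Finset.coe_filter, Finset.mem_univ, true_and, mem_ofPred_eq]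
    rw [abs_le]
    omega
  · simp only [Fin.mk.injEq] at hii
    ext
    omega

/-- The point of the grid of pitch `4 ε` with integer coordinates `z`. -/
noncomputable def gridPoint {d N : ℕ} (ε : ℝ) (z : Fin d → Fin N) : EuclideanSpace ℝ (Fin d) :=
  WithLp.toLp 2 fun i => 4 * ε * (z i : ℕ)

/-- The point `-s` of the first coordinate axis. -/
noncomputable def axisPoint {d : ℕ} (hd : 1 ≤ d) (s : ℝ) : EuclideanSpace ℝ (Fin d) :=
  EuclideanSpace.single ⟨0, hd⟩ (-s)

theorem norm_axisPoint_sub {d : ℕ} (hd : 1 ≤ d) (s s' : ℝ) :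
    ‖axisPoint hd s - axisPoint hd s'‖ = |s - s'| := by
  have : axisPoint hd s - axisPoint hd s' = axisPoint hd (s - s') := by
    ext i
    by_cases h : i = ⟨0, hd⟩
    · simp [axisPoint, h]
      ring
    · simp [axisPoint, h]
  rw [this, axisPoint, PiLp.norm_single, norm_neg, Real.norm_eq_abs]

/-- The grid of cells next to a ball of high density. -/
noncomputable def gridDesign {d : ℕ} (hd : 1 ≤ d) (N : ℕ) {ε R t h a : ℝ} (hε : 0 < ε) (hR : 0 < R)
    (ht : 0 < t) (hta : t ≤ a) (hh : 0 < h) (hh2 : h ≤ 1 / 2)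
    (hmass : a * (R ^ d * unitBallVolume d) + N ^ d * (t * (ε ^ d * unitBallVolume d)) = 1) :
    HypercubeDesign d (Fin d → Fin N) where
  c := gridPoint ε
  p := axisPoint hd (R + 4 * ε)
  ε := ε
  R := R
  t := t
  a := a
  h := h
  ε_pos := hε
  R_pos := hR
  t_pos := ht
  t_le := hta
  h_pos := hh
  h_le := hh2
  sep_cells z z' hz := by
    obtain ⟨i, hi⟩ := Function.ne_iff.1 hz
    refine le_trans ?_ (abs_apply_le_norm _ i)
    simp only [gridPoint, PiLp.sub_apply]
    rw [← mul_sub, abs_mul, abs_of_pos (by linarith : 0 < 4 * ε)]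
    refine le_mul_of_one_le_right (by linarith) ?_
    have h1 : ((z i : ℕ) : ℤ) - ((z' i : ℕ) : ℤ) ≠ 0 := by
      rw [sub_ne_zero]
      exact_mod_cast fun h => hi (Fin.ext h)
    exact_mod_cast Int.one_le_abs h1
  sep_heavy z := by
    refine le_trans ?_ (abs_apply_le_norm _ ⟨0, hd⟩)
    simp only [gridPoint, axisPoint, PiLp.sub_apply, PiLp.single_apply, if_true]
    refine le_trans ?_ (le_abs_self _)
    have : 0 ≤ 4 * ε * ((z ⟨0, hd⟩ : ℕ) : ℝ) := by positivity
    linarith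
  mass := by
    rw [← hmass, Fintype.card_fun, Fintype.card_fin, Fintype.card_fin]
    push_cast
    rfl

section

variable {d : ℕ} {hd : 1 ≤ d} {N : ℕ} {ε R t h a : ℝ} {hε : 0 < ε} {hR : 0 < R}
    {ht : 0 < t} {hta : t ≤ a} {hh : 0 < h} {hh2 : h ≤ 1 / 2}
    {hmass : a * (R ^ d * unitBallVolume d) + N ^ d * (t * (ε ^ d * unitBallVolume d)) = 1}

theorem cellMass_gridDesign : (gridDesign hd N hε hR ht hta hh hh2 hmass).cellMass =
    N ^ d * (t * (ε ^ d * unitBallVolume d)) := by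
  rw [HypercubeDesign.cellMass, Fintype.card_fun, Fintype.card_fin, Fintype.card_fin]
  push_cast
  rfl

theorem norm_gridPoint_sub_le (hε : 0 < ε) {z z' : Fin d → Fin N} {j : ℕ}
    (hz : ∀ i, |((z' i : ℕ) : ℤ) - (z i : ℕ)| ≤ j) :
    ‖gridPoint ε z' - gridPoint ε z‖ ≤ d * (4 * ε * j) := by
  refine norm_le_card_mul _ (by positivity) fun i => ?_
  simp only [gridPoint, PiLp.sub_apply]
  rw [← mul_sub, abs_mul, abs_of_pos (by linarith : 0 < 4 * ε)]
  have : |((z' i : ℕ) : ℝ) - (z i : ℕ)| ≤ j := by exact_mod_cast hz i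
  gcongr

theorem norm_axisPoint_sub_gridPoint_le (hε : 0 < ε) (z : Fin d → Fin N) :
    ‖axisPoint hd (4 * ε) - gridPoint ε z‖ ≤ d * (4 * ε * N) := by
  refine norm_le_card_mul _ (by positivity) fun i => ?_
  have h1 : ((z i : ℕ) : ℝ) + 1 ≤ N := by exact_mod_cast (z i).2
  have h2 : (0 : ℝ) ≤ (z i : ℕ) := Nat.cast_nonneg _
  simp only [gridPoint, axisPoint, PiLp.sub_apply, PiLp.single_apply]
  rw [abs_le]
  split_ifs <;> constructor <;> nlinarith

/-- In every case the ball contains mass at least that of a ball of radius s ≥ δ/(10d) at the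
density of its center, which fixes the threshold on κ. Around a point of a cell three ranges of δ
occur, separated by 2ε and by 10dεN, a multiple of the size of the grid. -/
theorem gridDesign_mem_minimalMassClass {κ δ₀ : ℝ} (hκ : 0 < κ)
    (hκd : κ ≤ unitBallVolume d / (10 * d) ^ d) (hδ₀ : δ₀ ≤ R) (σ : (Fin d → Fin N) → SignType) :
    (gridDesign hd N hε hR ht hta hh hh2 hmass).model σ ∈ minimalMassClass d κ δ₀ := by
  intro δ hδ hδδ x hx
  have hδR : δ ≤ R := hδδ.trans hδ₀
  have hv := unitBallVolume_pos d
  have hd1 : (1 : ℝ) ≤ d := by exact_mod_cast hd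
  have hκ' : κ * (10 * d) ^ d ≤ unitBallVolume d := (le_div_iff₀ (by positivity)).1 hκd
  have ha : 0 < a := ht.trans_le hta
  have hscale : ∀ {s : ℝ}, 0 ≤ s → δ ≤ 10 * d * s → κ * δ ^ d ≤ s ^ d * unitBallVolume d := by
    intro s hs hδs
    calc κ * δ ^ d ≤ κ * (10 * d * s) ^ d := by gcongr
      _ = s ^ d * (κ * (10 * d) ^ d) := by rw [mul_pow _ s]; ring
      _ ≤ _ := by gcongr
  set D := gridDesign hd N hε hR ht hta hh hh2 hmass with hD
  rw [D.marginal_model]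
  change κ * D.density x * δ ^ d ≤ _
  rw [D.Ω_model] at hx
  rcases hx with hx | hx
  · rw [D.density_of_mem_heavy hx]
    obtain ⟨q, hq⟩ := exists_ball_subset_inter hx hδ (by linarith : δ ≤ 2 * R)
    have h1 := D.inputLaw_real_ball_of_subset_heavy (half_pos hδ) (hq.trans inter_subset_right)
    refine le_trans ?_ (measureReal_mono (hq.trans inter_subset_left))
    rw [h1]
    have h2 := hscale (half_pos hδ).le (by nlinarith)
    calc κ * D.a * δ ^ d = D.a * (κ * δ ^ d) := by ring
      _ ≤ _ := mul_le_mul_of_nonneg_left h2 D.a_pos.le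
  · obtain ⟨z, hz⟩ := mem_iUnion.1 hx
    rw [D.density_of_mem_cell hz]
    have hxz : ‖x - gridPoint ε z‖ < ε := mem_ball_iff_norm.1 hz
    have hDt : D.t = t := rfl
    have hDa : D.a = a := rfl
    have hDε : D.ε = ε := rfl
    rcases lt_or_ge δ (2 * ε) with hsmall | hδε
    · obtain ⟨q, hq⟩ := exists_ball_subset_inter (R := ε) hz hδ hsmall.le
      have h1 := D.inputLaw_real_ball_of_subset_cell (z := z) (half_pos hδ)
        (hq.trans inter_subset_right)
      refine le_trans ?_ (measureReal_mono (hq.trans inter_subset_left))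
      rw [h1]
      have h2 := hscale (half_pos hδ).le (by nlinarith)
      calc κ * D.t * δ ^ d = D.t * (κ * δ ^ d) := by ring
        _ ≤ _ := mul_le_mul_of_nonneg_left h2 D.t_pos.le
    rcases le_or_gt δ (10 * d * (ε * N)) with hmid | hlarge
    -- The largest j for which all cells within j grid steps in every coordinate lie in the ball:
    -- their points are at distance less than ε + 4dεj + ε from x. The cap at N accounts for the
    -- whole grid.
    · set j := ⌊(δ - 2 * ε) / (4 * d * ε)⌋₊ with hj
      set Z : Finset (Fin d → Fin N) := Fintype.piFinset fun i =>
        Finset.univ.filter fun z' : Fin N => |((z' : ℕ) : ℤ) - (z i : ℕ)| ≤ j with hZ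
      have hj1 : j * (4 * d * ε) ≤ δ - 2 * ε :=
        (le_div_iff₀ (by positivity)).1 (Nat.floor_le (div_nonneg (by linarith) (by positivity)))
      have hj2 : δ - 2 * ε < (j + 1) * (4 * d * ε) :=
        (div_lt_iff₀ (by positivity)).1 (Nat.lt_floor_add_one _)
      have hsub : (⋃ z' ∈ Z, D.cell z') ⊆ Metric.ball x δ := by
        refine iUnion₂_subset fun z' hz' => Metric.ball_subset_ball' ?_
        have h1 : ‖gridPoint ε z' - gridPoint ε z‖ ≤ d * (4 * ε * j) :=
          norm_gridPoint_sub_le hε fun i => by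
            simpa using Fintype.mem_piFinset.1 hz' i
        change ε + dist (gridPoint ε z') x ≤ δ
        rw [dist_eq_norm]
        have h2 := norm_sub_le_norm_sub_add_norm_sub (gridPoint ε z') (gridPoint ε z) x
        rw [norm_sub_rev (gridPoint ε z) x] at h2
        nlinarith
      have hcard : (min (j + 1) N) ^ d ≤ Z.card := by
        rw [hZ, Fintype.card_piFinset]
        refine le_trans (le_of_eq ?_) (Finset.prod_le_prod' fun i _ => min_le_card_filter (z i) j)
        simp
      have hmin : δ ≤ 10 * d * (ε * (min (j + 1) N : ℕ)) := by
        rcases min_choice (j + 1) N with h | h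
        · rw [h]
          push_cast
          have hj0 : (0 : ℝ) ≤ j := Nat.cast_nonneg _
          have : ε ≤ d * ε * (j + 1) := by
            nlinarith [mul_nonneg (mul_nonneg (by linarith : (0 : ℝ) ≤ d) hε.le) hj0]
          nlinarith
        · rw [h]
          exact hmid
      have h2 := hscale (by positivity) hmin
      refine le_trans ?_ (measureReal_mono hsub)
      rw [D.inputLaw_real_biUnion_cell, hDt, hDε]
      calc κ * t * δ ^ d = t * (κ * δ ^ d) := by ring
        _ ≤ t * ((ε * (min (j + 1) N : ℕ)) ^ d * unitBallVolume d) := by gcongr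
        _ = ((min (j + 1) N) ^ d : ℕ) * (t * (ε ^ d * unitBallVolume d)) := by
          push_cast
          rw [mul_pow]
          ring
        _ ≤ Z.card * (t * (ε ^ d * unitBallVolume d)) := by
          gcongr
    -- This ball touches the heavy sphere from inside at its point facing the grid. Its center is
    -- within δ/4 + 4dεN + ε of x, and 4dεN + ε ≤ 5dεN < δ/2; hence the factor 10.
    · have hq1 : Metric.ball (axisPoint hd (4 * ε + δ / 4)) (δ / 4) ⊆ D.heavy := by
        refine Metric.ball_subset_ball' ?_
        change δ / 4 + dist (axisPoint hd (4 * ε + δ / 4)) (axisPoint hd (R + 4 * ε)) ≤ R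
        rw [dist_eq_norm, norm_axisPoint_sub, abs_of_nonpos (by linarith)]
        linarith
      have hN : (1 : ℝ) ≤ N := by
        have : 0 < N := Nat.pos_of_ne_zero fun h => by
          have := (z ⟨0, hd⟩).2
          omega
        exact_mod_cast this
      have hq2 : Metric.ball (axisPoint hd (4 * ε + δ / 4)) (δ / 4) ⊆ Metric.ball x δ := by
        refine Metric.ball_subset_ball' ?_
        rw [dist_eq_norm]
        have h1 := norm_axisPoint_sub hd (4 * ε + δ / 4) (4 * ε)
        rw [add_sub_cancel_left, abs_of_pos (by linarith)] at h1
        have h2 := norm_axisPoint_sub_gridPoint_le (hd := hd) hε z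
        have h3 := norm_sub_le_norm_sub_add_norm_sub (axisPoint hd (4 * ε + δ / 4))
          (axisPoint hd (4 * ε)) x
        have h4 := norm_sub_le_norm_sub_add_norm_sub (axisPoint hd (4 * ε)) (gridPoint ε z) x
        rw [norm_sub_rev (gridPoint ε z) x] at h4
        have h5 : ε ≤ d * (ε * N) := by
          have : 1 ≤ (d : ℝ) * N := by nlinarith
          nlinarith
        nlinarith
      refine le_trans ?_ (measureReal_mono hq2)
      rw [D.inputLaw_real_ball_of_subset_heavy (by linarith) hq1, hDt, hDa]
      have h2 := hscale (s := δ / 4) (by linarith) (by nlinarith)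
      calc κ * t * δ ^ d = t * (κ * δ ^ d) := by ring
        _ ≤ t * ((δ / 4) ^ d * unitBallVolume d) := by gcongr
        _ ≤ _ := by gcongr

end

/-! ### Choice of the scales and the lower bound. -/

/-- The floor of the d-th root works, since a real number at least 1 is at most twice its floor. -/
theorem exists_pow_le_le_two_mul_pow {d : ℕ} (hd : 1 ≤ d) {y : ℝ} (hy : 1 ≤ y) :
    ∃ N : ℕ, (N : ℝ) ^ d ≤ y ∧ y ≤ 2 ^ d * (N : ℝ) ^ d := by
  have hd0 : d ≠ 0 := by omega
  have hy0 : 0 ≤ y := by linarith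
  have hroot : (y ^ ((d : ℝ)⁻¹)) ^ d = y := Real.rpow_inv_natCast_pow hy0 hd0
  have hroot1 : 1 ≤ y ^ ((d : ℝ)⁻¹) := Real.one_le_rpow hy (by positivity)
  refine ⟨⌊y ^ ((d : ℝ)⁻¹)⌋₊, ?_, ?_⟩
  · refine le_trans ?_ hroot.le
    exact pow_le_pow_left₀ (Nat.cast_nonneg _) (Nat.floor_le (by positivity)) d
  · rw [← mul_pow]
    refine hroot.symm.le.trans (pow_le_pow_left₀ (by positivity) ?_ d)
    have h1 := Nat.lt_floor_add_one (y ^ ((d : ℝ)⁻¹))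
    have h2 : (1 : ℝ) ≤ ⌊y ^ ((d : ℝ)⁻¹)⌋₊ := by
      exact_mod_cast Nat.le_floor (by exact_mod_cast hroot1)
    linarith

/-- The minimax lower bound at a given small scale `ε`. -/
theorem minimaxRisk_ge {d : ℕ} (hd : 1 ≤ d) {α L M r κ δ₀ ε₀ c b ε t : ℝ} {ψ : ℝ → ℝ}
    (hα : 0 < α) (hM : 0 < M) (hψ : StrictMonoOn ψ (Ioo 0 r)) (hψ0 : Tendsto ψ (𝓝[>] 0) (𝓝 0))
    (hκ : 0 < κ) (hκd : κ ≤ unitBallVolume d / (10 * d) ^ d) (hδ₀ : 0 < δ₀) (hε₀r : ε₀ ≤ r)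
    (hε₀ : ε₀ ≤ 1 / (2 * (δ₀ ^ d * unitBallVolume d)))
    (hc : 0 < c) (hcL : c ≤ L) (hc1 : c ≤ 1 / 2) (hcv : c ^ 2 * unitBallVolume d ≤ 1 / 96)
    (hb : 0 < b) (hb1 : b * unitBallVolume d ≤ 1) (hbM : b * unitBallVolume d ≤ M * c ^ α)
    (hε : 0 < ε) (hε1 : ε ≤ 1) (hεα : ε ^ α ≤ 1 / 2) (htε : t = tailInv ψ r (ε ^ α)) (ht : 0 < t)
    (ht1 : t ≤ 1 / (2 * (δ₀ ^ d * unitBallVolume d))) (htb : t ≤ b * ε ^ (α - d))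
    {n : ℕ} (hn : n * (ε ^ (2 + d) * t) ≤ 1) :
    ENNReal.ofReal (c * b * unitBallVolume d / (2 * 2 ^ d) * ε ^ (1 + α)) ≤
      minimaxRisk n (smoothMarginClass d L α M ∩ tailClass d ψ ε₀ ∩ minimalMassClass d κ δ₀) := by
  set v := unitBallVolume d with hv
  have hv0 : 0 < v := unitBallVolume_pos d
  -- The number of cells is chosen so that their total mass is b v ε^α up to a factor 2^d; the bound
  -- on t ensures that at least one cell is called for.
  obtain ⟨N, hN1, hN2⟩ := exists_pow_le_le_two_mul_pow hd ((one_le_div ht).2 htb)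
  have hεd : ε ^ (α - d) * ε ^ d = ε ^ α := by
    rw [← Real.rpow_natCast, ← Real.rpow_add hε, sub_add_cancel]
  have hεα0 : 0 < ε ^ α := by positivity
  set W : ℝ := N ^ d * (t * (ε ^ d * v)) with hW
  have hy : b * ε ^ (α - d) / t * (t * (ε ^ d * v)) = b * v * ε ^ α := by
    rw [← hεd]
    field_simp
  have hW1 : W ≤ b * v * ε ^ α := by
    rw [← hy]
    exact mul_le_mul_of_nonneg_right hN1 (by positivity)
  have hW2 : b * v * ε ^ α ≤ 2 ^ d * W := by
    rw [← hy, hW, ← mul_assoc (2 ^ d : ℝ)]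
    exact mul_le_mul_of_nonneg_right hN2 (by positivity)
  have hWα : W ≤ ε ^ α := hW1.trans (mul_le_of_le_one_left hεα0.le hb1)
  have hδv : 0 < δ₀ ^ d * v := by positivity
  -- The heavy ball has radius δ₀ and takes the remaining mass; W ≤ 1/2 keeps its density bounded
  -- below, uniformly in ε.
  set a : ℝ := (1 - W) / (δ₀ ^ d * v) with ha
  have ha1 : 1 / (2 * (δ₀ ^ d * v)) ≤ a := by
    rw [ha, ← div_div]
    gcongr
    linarith
  have hh2 : c * ε ≤ 1 / 2 := by nlinarith
  have hmass : a * (δ₀ ^ d * v) + N ^ d * (t * (ε ^ d * v)) = 1 := by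
    rw [ha, div_mul_cancel₀ _ hδv.ne', ← hW]
    ring
  set D := gridDesign hd N hε hδ₀ ht (ht1.trans ha1) (mul_pos hc hε) hh2 hmass with hD
  have hDW : D.cellMass = W := cellMass_gridDesign
  have hmem : ∀ σ, D.model σ ∈
      smoothMarginClass d L α M ∩ tailClass d ψ ε₀ ∩ minimalMassClass d κ δ₀ := by
    intro σ
    refine ⟨⟨D.model_mem_smoothMarginClass σ ?_ hα ?_ hM.le, D.model_mem_tailClass σ ?_ ?_ ?_⟩,
      gridDesign_mem_minimalMassClass hκ hκd le_rfl σ⟩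
    · exact mul_le_mul_of_nonneg_right hcL hε.le
    · rw [hDW]
      change W ≤ M * (c * ε) ^ α
      rw [Real.mul_rpow hc.le hε.le, ← mul_assoc]
      exact hW1.trans (mul_le_mul_of_nonneg_right hbM hεα0.le)
    · exact hε₀.trans ha1
    · exact fun e he he' => (pos_of_tendsto_zero hψ hψ0 ⟨he, he'.trans_le hε₀r⟩).le
    · intro e he he'
      rw [hDW]
      refine hWα.trans (le_of_tailInv_lt hψ ?_ ?_ (he'.trans_le hε₀r))
      · rwa [← htε]
      · rw [← htε]
        exact he
  have hn' : n * (4 * D.h ^ 2 * (D.t * (D.ε ^ d * v))) ≤ 1 / 24 := by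
    change n * (4 * (c * ε) ^ 2 * (t * (ε ^ d * v))) ≤ 1 / 24
    calc n * (4 * (c * ε) ^ 2 * (t * (ε ^ d * v)))
        = 4 * (c ^ 2 * v) * (n * (ε ^ (2 + d) * t)) := by ring
      _ ≤ 4 * (1 / 96) * 1 := by gcongr
      _ = 1 / 24 := by norm_num
  refine le_iInf fun Φ => ?_
  obtain ⟨τ, hτ⟩ := D.exists_excessRisk_ge Φ.2 hn'
  refine le_trans (ENNReal.ofReal_le_ofReal ?_)
    (le_iSup₂ (f := fun P _ => ENNReal.ofReal (ClassifModel.excessRisk P Φ.1)) _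
      (hmem (HypercubeDesign.vertex τ)))
  refine le_trans ?_ hτ
  rw [hDW]
  change _ ≤ c * ε * W / 2
  rw [Real.rpow_add hε, Real.rpow_one]
  calc c * b * v / (2 * 2 ^ d) * (ε * ε ^ α) = c * ε / (2 * 2 ^ d) * (b * v * ε ^ α) := by ring
    _ ≤ c * ε / (2 * 2 ^ d) * (2 ^ d * W) := by gcongr
    _ = c * ε * W / 2 := by
      field_simp

/-- Only the last bound depends on how α compares with d: for α ≤ d the power ε^(α-d) is at least 1
and the smallness of ψ⁻¹ suffices, for α > d it is the little-o hypothesis. -/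
theorem eventually_small_scale {d : ℕ} {α r b s₀ : ℝ} {ψ : ℝ → ℝ} (hα : 0 < α) (hr : 0 < r)
    (hψ : StrictMonoOn ψ (Ioo 0 r)) (hψ0 : Tendsto ψ (𝓝[>] 0) (𝓝 0)) (hb : 0 < b) (hs₀ : 0 < s₀)
    (hcond : (d : ℝ) < α →
      Tendsto (fun ε : ℝ => tailInv ψ r (ε ^ α) / ε ^ (α - d)) (𝓝[>] 0) (𝓝 0)) :
    ∀ᶠ ε : ℝ in 𝓝[>] 0, ε ≤ 1 ∧ ε ^ α ≤ 1 / 2 ∧ 0 < tailInv ψ r (ε ^ α) ∧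
      tailInv ψ r (ε ^ α) ≤ s₀ ∧ tailInv ψ r (ε ^ α) ≤ b * ε ^ (α - d) := by
  set s : ℝ := min (r / 2) (min s₀ b) with hs
  have hs0 : 0 < s := lt_min (by linarith) (lt_min hs₀ hb)
  have hsr : s < r := (min_le_left _ _).trans_lt (by linarith)
  have hss₀ : s ≤ s₀ := (min_le_right _ _).trans (min_le_left _ _)
  have hsb : s ≤ b := (min_le_right _ _).trans (min_le_right _ _)
  have hψs : 0 < ψ s := pos_of_tendsto_zero hψ hψ0 ⟨hs0, hsr⟩
  have hlim : Tendsto (fun ε : ℝ => ε ^ α) (𝓝[>] 0) (𝓝 0) := by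
    have h := (Real.continuousAt_rpow_const 0 α (Or.inr hα.le)).tendsto
    rw [Real.zero_rpow hα.ne'] at h
    exact h.mono_left nhdsWithin_le_nhds
  have hlast : ∀ᶠ ε : ℝ in 𝓝[>] 0, ε ≤ 1 → tailInv ψ r (ε ^ α) ≤ s →
      tailInv ψ r (ε ^ α) ≤ b * ε ^ (α - d) := by
    rcases lt_or_ge (d : ℝ) α with h | h
    · filter_upwards [(hcond h).eventually (gt_mem_nhds hb), self_mem_nhdsWithin] with ε h1 h2 _ _
      exact ((div_lt_iff₀ (Real.rpow_pos_of_pos h2 _)).1 h1).le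
    · filter_upwards [self_mem_nhdsWithin] with ε h1 h2 h3
      refine (h3.trans hsb).trans (le_mul_of_one_le_right hb.le ?_)
      exact Real.one_le_rpow_of_pos_of_le_one_of_nonpos h1 h2 (by linarith)
  filter_upwards [hlast, self_mem_nhdsWithin, Ioo_mem_nhdsGT one_pos,
    hlim.eventually (gt_mem_nhds (one_half_pos)), hlim.eventually (gt_mem_nhds hψs)]
    with ε h1 h2 h3 h4 h5
  have hts : tailInv ψ r (ε ^ α) ≤ s := tailInv_le hs0 hsr h5.le
  exact ⟨h3.2.le, h4.le, tailInv_pos hψ0 (Real.rpow_pos_of_pos h2 α) hs0 hsr h5.le,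
    hts.trans hss₀, h1 h3.2.le hts⟩

/-- Small solutions are handled by `minimaxRisk_ge`. For a larger solution the construction at the
fixed scale εs is used with the same n, which is allowed because the balance function is monotone.
-/
theorem minimax_lower_bound {d : ℕ} (hd : 1 ≤ d) {α L M r : ℝ} {ψ : ℝ → ℝ} (hα : 0 < α)
    (hL : 0 < L) (hM : 0 < M) (hr : 0 < r) (hψ : StrictMonoOn ψ (Ioo 0 r))
    (hψ0 : Tendsto ψ (𝓝[>] 0) (𝓝 0))
    (hcond : (d : ℝ) < α →
      Tendsto (fun ε : ℝ => tailInv ψ r (ε ^ α) / ε ^ (α - d)) (𝓝[>] 0) (𝓝 0))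
    {κ δ₀ : ℝ} (hκ : 0 < κ) (hκd : κ ≤ unitBallVolume d / (10 * d) ^ d) (hδ₀ : 0 < δ₀) :
    ∃ ε₁ : ℝ, 0 < ε₁ ∧ ∀ ε₀ : ℝ, 0 < ε₀ → ε₀ ≤ ε₁ →
      ∃ c : ℝ, 0 < c ∧ ∀ n : ℕ, 1 ≤ n → ∀ ε : ℝ, SolvesBalance d ψ r α n ε →
        ENNReal.ofReal (c * ε ^ (1 + α)) ≤ minimaxRisk n
          (smoothMarginClass d L α M ∩ tailClass d ψ ε₀ ∩ minimalMassClass d κ δ₀) := by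
  set v := unitBallVolume d with hv
  have hv0 : 0 < v := unitBallVolume_pos d
  set s₀ : ℝ := 1 / (2 * (δ₀ ^ d * v)) with hs₀
  have hs₀0 : 0 < s₀ := by positivity
  set c : ℝ := min L (min (1 / 2) (1 / (96 * v))) with hc
  have hc0 : 0 < c := lt_min hL (lt_min (by norm_num) (by positivity))
  have hc1 : c ≤ 1 / 2 := (min_le_right _ _).trans (min_le_left _ _)
  have hcv : c ^ 2 * v ≤ 1 / 96 := by
    have h1 : c ≤ 1 / (96 * v) := (min_le_right _ _).trans (min_le_right _ _)
    rw [le_div_iff₀ (by positivity)] at h1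
    have h2 : 0 < c * v := by positivity
    nlinarith
  -- The first bound keeps the cell mass below ε^α for the tail condition, the second below M(cε)^α
  -- for the margin condition.
  set b : ℝ := min 1 (M * c ^ α) / v with hb
  have hb0 : 0 < b := by
    have : 0 < M * c ^ α := by positivity
    exact div_pos (lt_min one_pos this) hv0
  have hbv : b * v = min 1 (M * c ^ α) := div_mul_cancel₀ _ hv0.ne'
  obtain ⟨εs, hεs0, hεs⟩ := mem_nhdsGT_iff_exists_Ioc_subset.1
    (eventually_small_scale (d := d) hα hr hψ hψ0 hb0 hs₀0 hcond)
  rw [mem_Ioi] at hεs0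
  refine ⟨min r s₀, lt_min hr hs₀0, fun ε₀ hε₀ hε₀' => ?_⟩
  have hsmall : ∀ ε, 0 < ε → ε ≤ εs → ∀ n : ℕ, n * (ε ^ (2 + d) * tailInv ψ r (ε ^ α)) ≤ 1 →
      ENNReal.ofReal (c * b * v / (2 * 2 ^ d) * ε ^ (1 + α)) ≤ minimaxRisk n
        (smoothMarginClass d L α M ∩ tailClass d ψ ε₀ ∩ minimalMassClass d κ δ₀) := by
    intro ε h0 h1 n hn
    obtain ⟨g1, g2, g3, g4, g5⟩ := hεs ⟨h0, h1⟩
    exact minimaxRisk_ge hd hα hM hψ hψ0 hκ hκd hδ₀ (hε₀'.trans (min_le_left _ _))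
      (hε₀'.trans (min_le_right _ _)) hc0 (min_le_left _ _) hc1 hcv hb0
      (hbv.trans_le (min_le_left _ _)) (hbv.trans_le (min_le_right _ _)) h0 g1 g2 rfl g3 g4 g5 hn
  have hT : 0 < tailInv ψ r (εs ^ α) := (hεs ⟨hεs0, le_rfl⟩).2.2.1
  set T := tailInv ψ r (εs ^ α) with hTdef
  -- Since n ≥ 1, solutions of the balance equation above εs are bounded by E: one above 1 satisfies
  -- εT ≤ ε^(2+d) ψ⁻¹(ε^α) ≤ 1.
  set E : ℝ := max 1 T⁻¹ with hE
  have hE1 : 1 ≤ E := le_max_left _ _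
  set c₀ : ℝ := c * b * v / (2 * 2 ^ d) with hc₀
  have hc₀0 : 0 < c₀ := by positivity
  have hα1 : 0 < 1 + α := by linarith
  have hq0 : 0 < (εs / E) ^ (1 + α) := by positivity
  refine ⟨c₀ * min 1 ((εs / E) ^ (1 + α)), mul_pos hc₀0 (lt_min one_pos hq0),
    fun n hn ε ⟨hε, hbal⟩ => ?_⟩
  have hn0 : (0 : ℝ) < n := by exact_mod_cast hn
  have hbal' : n * (ε ^ (2 + d) * tailInv ψ r (ε ^ α)) = 1 := by
    rw [← hbal, mul_inv_cancel₀ hn0.ne']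
  rcases le_or_gt ε εs with hle | hgt
  · refine le_trans (ENNReal.ofReal_le_ofReal ?_) (hsmall ε hε hle n hbal'.le)
    gcongr
    exact mul_le_of_le_one_right hc₀0.le (min_le_left _ _)
  · have htε : 0 < tailInv ψ r (ε ^ α) := by
      refine (tailInv_nonneg ψ r _).lt_of_ne fun h => ?_
      rw [← h, mul_zero, mul_zero] at hbal'
      exact zero_ne_one hbal'
    have hTε : T ≤ tailInv ψ r (ε ^ α) := tailInv_mono (by gcongr) htε
    have hn1 : n * (εs ^ (2 + d) * T) ≤ 1 := by
      rw [← hbal']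
      gcongr
    have hεE : ε ≤ E := by
      rcases le_or_gt ε 1 with h | h
      · exact h.trans hE1
      · refine le_trans ?_ (le_max_right _ _)
        rw [← one_div, le_div_iff₀ hT]
        calc ε * T ≤ ε ^ (2 + d) * tailInv ψ r (ε ^ α) :=
              mul_le_mul (le_self_pow₀ h.le (by omega)) hTε hT.le (by positivity)
          _ = (n : ℝ)⁻¹ := hbal.symm
          _ ≤ 1 := inv_le_one_of_one_le₀ (by exact_mod_cast hn)
    refine le_trans (ENNReal.ofReal_le_ofReal ?_) (hsmall εs hεs0 le_rfl n hn1)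
    rw [mul_assoc]
    refine mul_le_mul_of_nonneg_left ?_ hc₀0.le
    calc min 1 ((εs / E) ^ (1 + α)) * ε ^ (1 + α) ≤ (εs / E) ^ (1 + α) * E ^ (1 + α) := by
          gcongr
          exact min_le_right _ _
      _ = εs ^ (1 + α) := by
          rw [← Real.mul_rpow (by positivity) (by positivity), div_mul_cancel₀ _ (by positivity)]

theorem mainTheorem5 (d : ℕ) (hd : 1 ≤ d) :
    ∃ κ₀ : ℝ, 0 < κ₀ ∧
      ∀ (α L M : ℝ) (ψ : ℝ → ℝ) (r : ℝ), 0 < α → 0 < L → 0 < M → 0 < r →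
        StrictMonoOn ψ (Ioo 0 r) → Tendsto ψ (𝓝[>] 0) (𝓝 0) →
        (((d : ℝ) < α →
            Tendsto (fun ε : ℝ => tailInv ψ r (ε ^ α) / ε ^ (α - d)) (𝓝[>] 0) (𝓝 0)) →
          ∀ κ : ℝ, 0 < κ → κ ≤ κ₀ → ∀ δ₀ : ℝ, 0 < δ₀ →
            ∃ ε₁ : ℝ, 0 < ε₁ ∧ ∀ ε₀ : ℝ, 0 < ε₀ → ε₀ ≤ ε₁ →
              ∃ c : ℝ, 0 < c ∧ ∀ n : ℕ, 1 ≤ n → ∀ ε : ℝ, SolvesBalance d ψ r α n ε →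
                ENNReal.ofReal (c * ε ^ (1 + α)) ≤
                  minimaxRisk n
                    (smoothMarginClass d L α M ∩ tailClass d ψ ε₀ ∩ minimalMassClass d κ δ₀)) ∧
        (∀ κ δ₀ ε₀ : ℝ, 0 < κ → 0 < δ₀ → 0 < ε₀ →
          ∃ C : ℝ, 0 < C ∧ ∀ n : ℕ, 1 ≤ n → ∀ ν : ℝ, SolvesBalance d ψ r (1 + α) n ν →
            ⨆ P ∈ smoothMarginClass d L α M ∩ tailClass d ψ ε₀ ∩ minimalMassClass d κ δ₀,
                ENNReal.ofReal (P.excessRisk (knnClassifier n ⌊ν⁻¹ ^ 2⌋₊)) ≤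
              ENNReal.ofReal (C * ν ^ (1 + α))) := by
  have hv := unitBallVolume_pos d
  have hd0 : (0 : ℝ) < d := by exact_mod_cast hd
  refine ⟨unitBallVolume d / (10 * d) ^ d, by positivity, ?_⟩
  intro α L M ψ r hα hL hM hr hψ hψ0
  refine ⟨fun hcond κ hκ hκd δ₀ hδ₀ => ?_, fun κ δ₀ ε₀ hκ hδ₀ hε₀ => ?_⟩
  · exact minimax_lower_bound hd hα hL hM hr hψ hψ0 hcond hκ hκd hδ₀
  · exact knn_upper_bound hd hα hL hM hr hψ hψ0 hκ hδ₀ hε₀
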